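/- **Setting.** Let $N\ge 2$ and let $\Omega\subset\mathbb R^N$ be a bounded polyhedral domain: a connected open set with $\operatorname{int}\overline\Omega=\Omega$ whose closure is a polyhedron. Here a polyhedron is a nonempty compact set that is the closure of its interior and a finite union of finite intersections of closed half-spaces. Let $\mathcal T_h$ be a partition of $\overline\Omega$ into finitely many polyhedra $\kappa$ with pairwise disjoint interiors and $\operatorname{diam}\kappa\le h$. Let $\mathcal E_h$ be the set of faces, that is, of the sets $\kappa\cap\kappa'$ ($\kappa\ne\kappa'$) and $\kappa\cap\partial\Omega$ of Hausdorff dimension $N-1$. Let $\Gamma_{int}$ be the union of the $e\in\mathcal E_h$ with $\dim_H(e\cap\partial\Omega)<N-1$, let $dS$ be the surface measure, and let $\mathbf h(x)=\operatorname{diam}(e)$ for $x\in e\in\mathcal E_h$. Let $k,l\in\mathbb N_0$ with $l\ge k-1$, let $V=S^k(\mathcal T_h)$ be the space of functions that are polynomials of total degree at most $k$ on each element, and let $H=S^l(\mathcal T_h)^N$. Both carry the $L^2(\Omega)$ norm, written $\|\cdot\|$, and $\langle\cdot,\cdot\rangle$ is the $L^2$ inner product of $H$. For $v\in V$ and $\phi\in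 H$ put $[v]=v^+\nu^++v^-\nu^-$ and $\{\phi\}=\frac12(\phi^++\phi^-)$ on $\Gamma_{int}$, where $\pm$ denotes the traces from the two neighbouring elements and $\nu^\pm$ are their outward unit normals. Let $\nabla v$ be the elementwise gradient, and let the lifting $R(v)\in H$ be defined by $$\int_\Omega R(v)\cdot\phi\,dx=-\int_{\Gamma_{int}}[v]\cdot\{\phi\}\,dS\qquad\text{for all }\phi\in H.$$ Put $Bv=R(v)+\nabla v$. Let $p:\overline\Omega\to[p_1,2]$ with $p_1>1$ be log-Hölder continuous, i.e. $|p(x)-p(y)|\le C/\log(e+1/|x-y|)$, and let $p'(x)=p(x)/(p(x)-1)$. Let $\xi\in L^2(\Omega)$ and let $u_D\in L^2(\partial\Omega)$ be the boundary datum. Put $$F(q)=\int_\Omega|q|^{p(x)}dx,\qquad G(v)=\int_\Omega|v-\xi|^2dx+\int_{\Gamma_{int}}|[v]|^2\,\mathbf h^{-2/p'(x)}dS+\int_{\partial\Omega}|v-u_D|^2\,\mathbf h^{-2/p'(x)}dS,$$ and, for $r\in\mathbb R$, $$\mathcal L_r(v,q,\mu)=F(q)+G(v)+\langle\mu,Bv-q\rangle+\tfrac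 r2\|Bv-q\|^2,\qquad (v,q,\mu)\in V\times H\times H.$$ **Theorem.** Let $(u_h,\eta_h,\lambda_h)\in V\times H\times H$ be a saddle point of $\mathcal L_r$, i.e. $\mathcal L_r(u_h,\eta_h,\mu)\le\mathcal L_r(u_h,\eta_h,\lambda_h)\le\mathcal L_r(v,q,\lambda_h)$ for all $(v,q,\mu)\in V\times H\times H$. Let $0<\alpha_0\le\rho_n\le\alpha_1<2r$ for all $n\ge0$. Let $\lambda_h^0\in H$ be arbitrary, and for $n\ge 0$ let $(u_h^n,\eta_h^n,\lambda_h^{n+1})\in V\times H\times H$ satisfy (Algorithm 1) $$\mathcal L_r(u_h^n,\eta_h^n,\lambda_h^n)\le\mathcal L_r(v,q,\lambda_h^n)\quad\text{for all }(v,q)\in V\times H,\qquad \lambda_h^{n+1}=\lambda_h^n+\rho_n(Bu_h^n-\eta_h^n).$$ Then, as $n\to\infty$, $$u_h^n\to u_h\ \text{in }V,\qquad \eta_h^n\to\eta_h=Bu_h\ \text{in }H,\qquad \lambda_h^{n+1}-\lambda_h^n\to0\ \text{in }H,$$ and the sequence $(\lambda_h^n)_n$ is bounded in $H$. Moreover $$[u_h^n-u_h]\to0\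 \text{in }L^2(\Gamma_{int}),\qquad u_h^n\to u_h\ \text{in }L^2(\partial\Omega),\qquad R(u_h^n)\to R(u_h)\ \text{in }H,\qquad \nabla u_h^n\to\nabla u_h\ \text{in }H.$$ -/

import Mathlib

open MeasureTheory Filter Topology Set
open scoped ENNReal RealInnerProductSpace

noncomputable section

namespace DG

/-- `E N` is the Euclidean space `ℝ^N`. -/
abbrev E (N : ℕ) : Type := EuclideanSpace ℝ (Fin N)

/-- The surface measure `dS` on `ℝ^N`: the `(N-1)`-dimensional Hausdorff measure, normalized so that
on hyperplanes it is the `(N-1)`-dimensional Lebesgue measure. -/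
def surfaceMeasure (N : ℕ) : Measure (E N) := Measure.euclideanHausdorffMeasure (N - 1)

/-! ### Polyhedra, outward normals, meshes -/

/-- A (closed, solid, not necessarily convex) polyhedron in `ℝ^N`: a nonempty compact set which is
the closure of its interior and a finite union of finite intersections of closed half-spaces
`{x | ⟪a, x⟫ ≤ b}`; the half-spaces are recorded as pairs `(a, b)`. -/
structure IsPolyhedron {N : ℕ} (K : Set (E N)) : Prop where
  isCompact : IsCompact K
  nonempty : K.Nonempty
  closure_interior : closure (interior K) = K
  halfspaces : ∃ P : Finset (Finset (E N × ℝ)),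
    K = ⋃ C ∈ P, ⋂ c ∈ C, {x : E N | ⟪c.1, x⟫ ≤ c.2}

/-- A bounded polyhedral domain: a connected open set whose closure is a polyhedron and which lies
on one side of its boundary (so there are no slits). -/
structure IsPolyhedralDomain {N : ℕ} (Ω : Set (E N)) : Prop where
  isOpen : IsOpen Ω
  isConnected : IsConnected Ω
  closure_isPolyhedron : IsPolyhedron (closure Ω)
  interior_closure : interior (closure Ω) = Ω

/-- `ν` is the outward unit normal to `K` at `x`: near `x`, the set `K` is the half-space
`{y | ⟪y - x, ν⟫ ≤ 0}`. -/
def IsOuterNormal {N : ℕ} (K : Set (E N)) (x ν : E N) : Prop :=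
  ‖ν‖ = 1 ∧ ∀ᶠ y in 𝓝 x, (y ∈ K ↔ ⟪y - x, ν⟫ ≤ 0)

open Classical in
/-- The outward unit normal to `K` at `x`, and `0` at all the points that have none, that is, off
`∂K` and at the edges of `K` (which are negligible in `∂K` for the surface measure). -/
def outerNormal {N : ℕ} (K : Set (E N)) (x : E N) : E N :=
  if h : ∃ ν, IsOuterNormal K x ν then h.choose else 0

theorem IsOuterNormal.eq {N : ℕ} {K : Set (E N)} {x ν μ : E N} (hν : IsOuterNormal K x ν)
    (hμ : IsOuterNormal K x μ) : ν = μ := by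
  have key : ∀ᶠ y in 𝓝 x, (⟪y - x, ν⟫ ≤ 0 ↔ ⟪y - x, μ⟫ ≤ 0) := by
    filter_upwards [hν.2, hμ.2] with y h1 h2
    rw [← h1, ← h2]
  have hcont : Tendsto (fun t : ℝ => x + t • (ν - μ)) (𝓝[>] 0) (𝓝 x) := by
    have : Continuous (fun t : ℝ => x + t • (ν - μ)) := by fun_prop
    have h2 := this.tendsto 0
    simp only [zero_smul, add_zero] at h2
    exact h2.mono_left nhdsWithin_le_nhds
  obtain ⟨t, ht, htpos⟩ := ((hcont.eventually key).and self_mem_nhdsWithin).exists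
  have htpos' : (0 : ℝ) < t := htpos
  simp only [add_sub_cancel_left, inner_smul_left, inner_sub_left, real_inner_self_eq_norm_sq,
    hν.1, hμ.1, RCLike.conj_to_real] at ht
  have hle : ⟪ν, μ⟫ ≤ 1 := by
    have := real_inner_le_norm ν μ
    rwa [hν.1, hμ.1, one_mul] at this
  have h1 : t * (⟪ν, μ⟫ - 1 ^ 2) ≤ 0 := by nlinarith
  have h2 := ht.2 h1
  have h3 : ⟪ν, μ⟫ = 1 := by
    have : 1 ^ 2 - ⟪ν, μ⟫ ≤ 0 := by
      by_contra hc
      push Not at hc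
      rw [real_inner_comm] at h2
      exact absurd h2 (not_le.2 (mul_pos htpos' hc))
    linarith
  exact (inner_eq_one_iff_of_norm_eq_one hν.1 hμ.1).1 h3

theorem outerNormal_eq {N : ℕ} {K : Set (E N)} {x ν : E N} (hν : IsOuterNormal K x ν) :
    outerNormal K x = ν := by
  have hex : ∃ ν, IsOuterNormal K x ν := ⟨ν, hν⟩
  rw [outerNormal, dif_pos hex]
  exact IsOuterNormal.eq hex.choose_spec hν

theorem IsOuterNormal.mem_frontier {N : ℕ} {K : Set (E N)} {x ν : E N} (hν : IsOuterNormal K x ν) :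
    x ∈ frontier K := by
  have hx : x ∈ K := hν.2.self_of_nhds.2 (by simp)
  refine ⟨subset_closure hx, fun hi => ?_⟩
  have hK : ∀ᶠ y in 𝓝 x, y ∈ K := mem_interior_iff_mem_nhds.1 hi
  have hcont : Tendsto (fun t : ℝ => x + t • ν) (𝓝[>] 0) (𝓝 x) := by
    have : Continuous (fun t : ℝ => x + t • ν) := by fun_prop
    have h2 := this.tendsto 0
    simp only [zero_smul, add_zero] at h2
    exact h2.mono_left nhdsWithin_le_nhds
  obtain ⟨t, ⟨h1, h2⟩, h3⟩ :=
    ((hcont.eventually (hν.2.and hK)).and self_mem_nhdsWithin).exists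
  have h4 := h1.1 h2
  have h3' : (0 : ℝ) < t := h3
  simp only [add_sub_cancel_left, inner_smul_left, real_inner_self_eq_norm_sq, hν.1,
    RCLike.conj_to_real] at h4
  linarith

theorem norm_outerNormal_le {N : ℕ} (K : Set (E N)) (x : E N) : ‖outerNormal K x‖ ≤ 1 := by
  by_cases hx : ∃ ν, IsOuterNormal K x ν
  · obtain ⟨ν, hν⟩ := hx
    rw [outerNormal_eq hν, hν.1]
  · rw [outerNormal, dif_neg hx]; simp

/-- Near a point of `∂K` that has an outward normal, all points of `∂K` have the same one. -/
theorem IsOuterNormal.eventually {N : ℕ} {K : Set (E N)} {x ν : E N} (hν : IsOuterNormal K x ν) :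
    ∀ᶠ y in 𝓝 x, y ∈ frontier K → IsOuterNormal K y ν := by
  filter_upwards [hν.2.eventually_nhds] with y hy hyK
  have hloc : K =ᶠ[𝓝 y] {z | ⟪z - x, ν⟫ ≤ 0} := by
    filter_upwards [hy] with z hz
    exact propext hz
  have h0 : ⟪y - x, ν⟫ = 0 := by
    have hcl : IsClosed {z : E N | ⟪z - x, ν⟫ ≤ 0} :=
      isClosed_le (by fun_prop) continuous_const
    have hop : IsOpen {z : E N | ⟪z - x, ν⟫ < 0} := isOpen_lt (by fun_prop) continuous_const
    rcases lt_trichotomy ⟪y - x, ν⟫ 0 with h | h | h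
    · exfalso
      refine hyK.2 (mem_interior_iff_mem_nhds.2 ?_)
      filter_upwards [hy, hop.mem_nhds h] with z hz hz'
      exact hz.2 (le_of_lt hz')
    · exact h
    · exfalso
      have : ∀ᶠ z in 𝓝 y, z ∉ K := by
        filter_upwards [hy, hcl.isOpen_compl.mem_nhds
          (show y ∈ {z : E N | ⟪z - x, ν⟫ ≤ 0}ᶜ from not_le.2 h)] with z hz hz' hzK
        exact hz' (hz.1 hzK)
      obtain ⟨z, hz1, hz2⟩ := (this.and_frequently (mem_closure_iff_frequently.1 hyK.1)).exists
      exact hz1 hz2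
  refine ⟨hν.1, ?_⟩
  filter_upwards [hy] with z hz
  rw [hz]
  have : ⟪z - x, ν⟫ = ⟪z - y, ν⟫ := by
    rw [← sub_add_sub_cancel z y x, inner_add_left, h0, add_zero]
  rw [this]

theorem measurable_outerNormal {N : ℕ} (K : Set (E N)) : Measurable (outerNormal K) := by
  classical
  have hD : ∀ U : Set (E N), MeasurableSet {x | ∃ ν ∈ U, IsOuterNormal K x ν} := by
    intro U
    have : {x | ∃ ν ∈ U, IsOuterNormal K x ν} =
        frontier K ∩ interior {y | y ∈ frontier K → ∃ ν ∈ U, IsOuterNormal K y ν} := by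
      ext x
      constructor
      · rintro ⟨ν, hU, hν⟩
        refine ⟨hν.mem_frontier, mem_interior_iff_mem_nhds.2 ?_⟩
        filter_upwards [hν.eventually] with y hy hyK
        exact ⟨ν, hU, hy hyK⟩
      · rintro ⟨h1, h2⟩
        exact interior_subset h2 h1
    rw [this]
    exact isClosed_frontier.measurableSet.inter isOpen_interior.measurableSet
  refine measurable_of_isOpen fun U _ => ?_
  have : outerNormal K ⁻¹' U = {x | ∃ ν ∈ U, IsOuterNormal K x ν} ∪
      (if (0 : E N) ∈ U then {x | ∃ ν ∈ (univ : Set (E N)), IsOuterNormal K x ν}ᶜ else ∅) := by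
    ext x
    by_cases hx : ∃ ν, IsOuterNormal K x ν
    · obtain ⟨ν, hν⟩ := hx
      have hiff : (∃ μ ∈ U, IsOuterNormal K x μ) ↔ ν ∈ U :=
        ⟨fun ⟨μ, h1, h2⟩ => hν.eq h2 ▸ h1, fun h => ⟨ν, h, hν⟩⟩
      have hex : ∃ ν ∈ (univ : Set (E N)), IsOuterNormal K x ν := ⟨ν, trivial, hν⟩
      by_cases h0 : (0 : E N) ∈ U
      · simp only [mem_preimage, outerNormal_eq hν, h0, if_true, mem_union, mem_ofPred_eq, hiff,
          mem_compl_iff, hex, not_true, or_false]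
      · simp only [mem_preimage, outerNormal_eq hν, h0, if_false, mem_union, mem_ofPred_eq, hiff,
          mem_empty_iff_false, or_false]
    · have h1 : outerNormal K x = 0 := by rw [outerNormal, dif_neg hx]
      have h2 : ¬ ∃ ν ∈ U, IsOuterNormal K x ν := fun ⟨ν, _, h⟩ => hx ⟨ν, h⟩
      have h3 : ¬ ∃ ν ∈ (univ : Set (E N)), IsOuterNormal K x ν := fun ⟨ν, _, h⟩ => hx ⟨ν, h⟩
      by_cases h0 : (0 : E N) ∈ U
      · simp only [mem_preimage, h1, h0, if_true, mem_union, mem_ofPred_eq, h2, mem_compl_iff, h3,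
          not_false_iff, or_true]
      · simp only [mem_preimage, h1, h0, if_false, mem_union, mem_ofPred_eq, h2,
          mem_empty_iff_false, or_false]
  rw [this]
  refine (hD U).union ?_
  split_ifs
  · exact (hD univ).compl
  · exact MeasurableSet.empty

theorem surfaceMeasure_hyperplane_lt_top {N : ℕ} {a : E N} (ha : a ≠ 0) (b : ℝ) {s : Set (E N)}
    (hs : Bornology.IsBounded s) : surfaceMeasure N ({x | ⟪a, x⟫ = b} ∩ s) < ∞ := by
  set L : Submodule ℝ (E N) := (ℝ ∙ a)ᗮ with hL
  have hfr : Module.finrank ℝ L = N - 1 := by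
    have h1 := Submodule.finrank_add_finrank_orthogonal (ℝ ∙ a)
    rw [finrank_span_singleton ha, finrank_euclideanSpace, Fintype.card_fin] at h1
    have h2 : Module.finrank ℝ L = Module.finrank ℝ (ℝ ∙ a)ᗮ := rfl
    omega
  set c : E N := (b / ‖a‖ ^ 2) • a
  have hc : ⟪a, c⟫ = b := by
    have : ‖a‖ ≠ 0 := norm_ne_zero_iff.2 ha
    rw [inner_smul_right, real_inner_self_eq_norm_sq]
    field_simp
  set f : L → E N := fun y => (y : E N) + c
  have hf : Isometry f := (isometry_add_right c).comp isometry_subtype_coe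
  have hsub : {x | ⟪a, x⟫ = b} ∩ s ⊆ f '' (f ⁻¹' s) := by
    rintro x ⟨hx, hxs⟩
    have hmem : x - c ∈ L := by
      rw [hL, Submodule.mem_orthogonal_singleton_iff_inner_right, inner_sub_right, hc, hx, sub_self]
    have hfx : f ⟨x - c, hmem⟩ = x := by simp [f]
    exact ⟨⟨x - c, hmem⟩, by rw [mem_preimage, hfx]; exact hxs, hfx⟩
  have hb : Bornology.IsBounded (f ⁻¹' s) := by
    obtain ⟨C, hC⟩ := Metric.isBounded_iff.1 hs
    exact Metric.isBounded_iff.2 ⟨C, fun x hx y hy => by rw [← hf.dist_eq]; exact hC hx hy⟩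
  refine (measure_mono hsub).trans_lt ?_
  rw [surfaceMeasure, hf.euclideanHausdorffMeasure_image, ← hfr]
  exact hb.measure_lt_top

theorem IsPolyhedron.surfaceMeasure_frontier_lt_top {N : ℕ} {K : Set (E N)} (hK : IsPolyhedron K) :
    surfaceMeasure N (frontier K) < ∞ := by
  obtain ⟨P, hP⟩ := hK.halfspaces
  have hbd : Bornology.IsBounded K := hK.isCompact.isBounded
  have hsub : frontier K ⊆
      ⋃ C ∈ P, ⋃ c ∈ C, ({x | c.1 ≠ 0 ∧ ⟪c.1, x⟫ = c.2} ∩ K) := by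
    intro x hx
    have hxK : x ∈ K := hK.isCompact.isClosed.frontier_subset hx
    by_contra hcon
    simp only [mem_iUnion, mem_inter_iff, mem_ofPred_eq, not_exists, not_and] at hcon
    have hloc : ∀ C ∈ P, ∀ c ∈ C, ∀ᶠ y in 𝓝 x, (⟪c.1, y⟫ ≤ c.2 ↔ ⟪c.1, x⟫ ≤ c.2) := by
      intro C hC c hc
      by_cases h0 : c.1 = 0
      · simp [h0]
      have hne : ⟪c.1, x⟫ ≠ c.2 := fun h => hcon C hC c hc ⟨h0, h⟩ hxK
      have hct : Tendsto (fun y : E N => ⟪c.1, y⟫) (𝓝 x) (𝓝 ⟪c.1, x⟫) :=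
        (by fun_prop : Continuous fun y : E N => ⟪c.1, y⟫).tendsto x
      rcases lt_or_gt_of_ne hne with h | h
      · filter_upwards [hct.eventually_lt_const h] with y hy
        exact ⟨fun _ => h.le, fun _ => hy.le⟩
      · filter_upwards [hct.eventually_const_lt h] with y hy
        exact ⟨fun h' => absurd h' (not_le.2 hy), fun h' => absurd h' (not_le.2 h)⟩
    refine hx.2 (mem_interior_iff_mem_nhds.2 ?_)
    rw [hP] at hxK
    simp only [mem_iUnion, mem_iInter] at hxK
    obtain ⟨C, hC, hxC⟩ := hxK
    have hall : ∀ᶠ y in 𝓝 x, ∀ c ∈ C, (⟪c.1, y⟫ ≤ c.2 ↔ ⟪c.1, x⟫ ≤ c.2) :=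
      (Finset.eventually_all C).2 (hloc C hC)
    filter_upwards [hall] with y hy
    rw [hP]
    simp only [mem_iUnion, mem_iInter]
    exact ⟨C, hC, fun c hc => (hy c hc).2 (hxC c hc)⟩
  refine (measure_mono hsub).trans_lt ?_
  refine (measure_biUnion_lt_top P.finite_toSet fun C _ => ?_)
  refine (measure_biUnion_lt_top C.finite_toSet fun c _ => ?_)
  by_cases h0 : c.1 = 0
  · simp [h0]
  · refine (measure_mono ?_).trans_lt (surfaceMeasure_hyperplane_lt_top h0 c.2 hbd)
    exact inter_subset_inter_left _ fun x hx => hx.2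

/-- A partition of the closure of the polyhedral domain `Ω` into finitely many polyhedra with
pairwise disjoint interiors and of diameter at most `h`. -/
structure Mesh {N : ℕ} (Ω : Set (E N)) (h : ℝ) where
  cells : Finset (Set (E N))
  domain : IsPolyhedralDomain Ω
  isPolyhedron : ∀ κ ∈ cells, IsPolyhedron κ
  iUnion_cells : (⋃ κ ∈ cells, κ) = closure Ω
  disjoint_interior : ∀ κ ∈ cells, ∀ κ' ∈ cells, κ ≠ κ' → Disjoint (interior κ) (interior κ')
  diam_le : ∀ κ ∈ cells, Metric.diam κ ≤ h

namespace Mesh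

variable {N : ℕ} {Ω : Set (E N)} {h : ℝ} (T : Mesh Ω h)

/-- The set `𝓔_h` of the faces: the intersections of two different elements, or of an element with
`∂Ω`, which have Hausdorff dimension `N - 1`. -/
def faces : Set (Set (E N)) :=
  {e | ∃ κ ∈ T.cells, ∃ κ' ∈ T.cells, κ ≠ κ' ∧ e = κ ∩ κ' ∧ dimH e = (N - 1 : ℕ)} ∪
  {e | ∃ κ ∈ T.cells, e = κ ∩ frontier Ω ∧ dimH e = (N - 1 : ℕ)}

/-- `Γ_int`, the union of the interior faces. -/
def interiorFaces : Set (E N) :=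
  ⋃₀ {e | e ∈ T.faces ∧ dimH (e ∩ frontier Ω) < (N - 1 : ℕ)}

/-- The local mesh size: `diam e` for `x` on the face `e`. (For the surface measure, almost every
point of `∂Ω ∪ Γ_int` lies on exactly one face.) -/
def localSize (x : E N) : ℝ := sSup {d | ∃ e ∈ T.faces, x ∈ e ∧ d = Metric.diam e}

/-! ### Piecewise polynomials -/

/-- The space `S^k(T)` of the functions that are polynomials of total degree at most `k` on each
element: such a function is given by one polynomial for each element. -/
abbrev PolySpace (k : ℕ) : Type := T.cells → MvPolynomial.restrictTotalDegree (Fin N) ℝ k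

/-- The space `S^l(T)^N` of piecewise polynomial vector fields. -/
abbrev VecSpace (l : ℕ) : Type := Fin N → T.PolySpace l

variable {T} {k l : ℕ}

/-- The value at `x` of the piece of `v` on the element `κ`; for `x ∈ ∂κ` it is the trace from `κ`. -/
def piece (v : T.PolySpace k) (κ : T.cells) (x : E N) : ℝ :=
  MvPolynomial.eval (fun i => x i) (v κ : MvPolynomial (Fin N) ℝ)

/-- The average at `x` of the values of `v` from the elements that contain `x`. For almost every
`x ∈ Ω` there is one such element, and this is `v x`; for almost every `x ∈ ∂Ω` there is one, and
this is the trace of `v` on `∂Ω`; for almost every `x ∈ Γ_int` there are two, and this is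
`{v} = (v⁺ + v⁻) / 2`. It is `0` outside the closure of `Ω`. -/
def val (v : T.PolySpace k) (x : E N) : ℝ :=
  (∑ κ : T.cells, (κ : Set (E N)).indicator (piece v κ) x) /
    ∑ κ : T.cells, (κ : Set (E N)).indicator (fun _ => (1 : ℝ)) x

/-- The value at `x` of a piecewise polynomial vector field, with the convention of `val`; for
almost every `x ∈ Γ_int` it is `{φ} = (φ⁺ + φ⁻) / 2`. -/
def vecVal (φ : T.VecSpace l) (x : E N) : E N := WithLp.toLp 2 fun i => val (φ i) x

/-- The jump `v⁺ ν⁺ + v⁻ ν⁻` at `x ∈ Γ_int`: the sum of `v_κ(x) ν_κ(x)` over the elements `κ` with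
`x ∈ ∂κ` (almost every `x ∈ Γ_int` lies on the boundary of exactly two elements). -/
def jump (v : T.PolySpace k) (x : E N) : E N :=
  ∑ κ : T.cells, piece v κ x • outerNormal (κ : Set (E N)) x

/-- The inner product of `L²(Ω)^N`. -/
def inner2 (q φ : T.VecSpace l) : ℝ := ∫ x in Ω, ⟪vecVal q x, vecVal φ x⟫

/-! ### The broken gradient -/

theorem pderiv_mem (hkl : k ≤ l + 1) (i : Fin N) (p : MvPolynomial (Fin N) ℝ)
    (hp : p ∈ MvPolynomial.restrictTotalDegree (Fin N) ℝ k) :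
    MvPolynomial.pderiv i p ∈ MvPolynomial.restrictTotalDegree (Fin N) ℝ l := by
  rw [MvPolynomial.mem_restrictTotalDegree] at hp
  rw [p.as_sum, map_sum]
  refine Submodule.sum_mem _ fun s hs => ?_
  rw [MvPolynomial.pderiv_monomial, MvPolynomial.mem_restrictTotalDegree]
  have h1 : (s.sum fun _ e => e) ≤ k := (MvPolynomial.le_totalDegree hs).trans hp
  by_cases hsi : s i = 0
  · simp [hsi]
  refine (MvPolynomial.totalDegree_monomial_le _ _).trans ?_
  have h2 : s = (s - Finsupp.single i 1) + Finsupp.single i 1 := by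
    ext j
    by_cases hj : i = j
    · subst hj; simp; omega
    · simp [hj]
  have h3 : (s.sum fun _ e => e) = ((s - Finsupp.single i 1).sum fun _ e => e) + 1 := by
    conv_lhs => rw [h2]
    rw [Finsupp.sum_add_index' (by simp) (by simp)]
    simp
  have h4 : ((s - Finsupp.single i 1).sum fun _ e => e) ≤ l := by omega
  exact h4

/-- The elementwise gradient `∇v`, as an element of `S^l(T)^N`, where `k - 1 ≤ l`. -/
def grad (hkl : k ≤ l + 1) (v : T.PolySpace k) : T.VecSpace l := fun i κ =>
  ⟨MvPolynomial.pderiv i (v κ : MvPolynomial (Fin N) ℝ), pderiv_mem hkl i _ (v κ).2⟩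

/-! ### The lifting operator -/

theorem continuous_piece (v : T.PolySpace k) (κ : T.cells) : Continuous (piece v κ) := by
  have h1 := MvPolynomial.continuous_eval (v κ : MvPolynomial (Fin N) ℝ)
  exact h1.comp (PiLp.continuous_ofLp 2 _)

theorem isClosed_cell (κ : T.cells) : IsClosed (κ : Set (E N)) :=
  (T.isPolyhedron κ κ.2).isCompact.isClosed

theorem exists_bound_piece (v : T.PolySpace k) (κ : T.cells) :
    ∃ C, 0 ≤ C ∧ ∀ x ∈ (κ : Set (E N)), |piece v κ x| ≤ C := by
  obtain ⟨C, hC⟩ := (T.isPolyhedron κ κ.2).isCompact.exists_bound_of_continuousOn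
    (continuous_piece v κ).continuousOn
  refine ⟨max C 0, le_max_right _ _, fun x hx => (hC x hx).trans (le_max_left _ _)⟩

theorem measurable_val (v : T.PolySpace k) : Measurable (val v) := by
  refine Measurable.div ?_ ?_
  · exact Finset.measurable_fun_sum _ fun κ _ =>
      (continuous_piece v κ).measurable.indicator (isClosed_cell κ).measurableSet
  · exact Finset.measurable_fun_sum _ fun κ _ =>
      measurable_const.indicator (isClosed_cell κ).measurableSet

theorem exists_bound_val (v : T.PolySpace k) : ∃ C, ∀ x, |val v x| ≤ C := by
  choose C hC0 hC using exists_bound_piece v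
  refine ⟨∑ κ, C κ, fun x => ?_⟩
  have hnum : |∑ κ : T.cells, (κ : Set (E N)).indicator (piece v κ) x| ≤ ∑ κ, C κ := by
    refine (Finset.abs_sum_le_sum_abs _ _).trans (Finset.sum_le_sum fun κ _ => ?_)
    by_cases hx : x ∈ (κ : Set (E N))
    · rw [indicator_of_mem hx]; exact hC κ x hx
    · rw [indicator_of_notMem hx]; simpa using hC0 κ
  by_cases hx : ∃ κ : T.cells, x ∈ (κ : Set (E N))
  · obtain ⟨κ, hx⟩ := hx
    have hden : 1 ≤ ∑ κ : T.cells, (κ : Set (E N)).indicator (fun _ => (1 : ℝ)) x := by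
      have := Finset.single_le_sum
        (f := fun κ : T.cells => (κ : Set (E N)).indicator (fun _ => (1 : ℝ)) x)
        (fun κ _ => indicator_nonneg (fun _ _ => zero_le_one) x) (Finset.mem_univ κ)
      simpa [indicator_of_mem hx] using this
    rw [val, abs_div, abs_of_pos (zero_lt_one.trans_le hden)]
    exact (div_le_self (abs_nonneg _) hden).trans hnum
  · push Not at hx
    have : val v x = 0 := by
      rw [val, Finset.sum_eq_zero fun κ _ => indicator_of_notMem (hx κ) _, zero_div]
    rw [this, abs_zero]
    exact Finset.sum_nonneg fun κ _ => hC0 κ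

theorem measurable_vecVal (φ : T.VecSpace l) : Measurable (vecVal φ) :=
  (WithLp.measurable_toLp 2 _).comp (measurable_pi_lambda _ fun i => measurable_val (φ i))

theorem exists_bound_vecVal (φ : T.VecSpace l) : ∃ C, ∀ x, ‖vecVal φ x‖ ≤ C := by
  choose C hC using fun i => exists_bound_val (φ i)
  refine ⟨√(∑ i, C i ^ 2), fun x => ?_⟩
  rw [EuclideanSpace.norm_eq]
  refine Real.sqrt_le_sqrt (Finset.sum_le_sum fun i _ => ?_)
  exact pow_le_pow_left₀ (norm_nonneg _) (hC i x) 2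

theorem measurable_jump (v : T.PolySpace k) : Measurable (jump v) :=
  Finset.measurable_fun_sum _ fun κ _ =>
    (continuous_piece v κ).measurable.smul (measurable_outerNormal _)

theorem exists_bound_jump (v : T.PolySpace k) : ∃ C, ∀ x, ‖jump v x‖ ≤ C := by
  choose C hC0 hC using exists_bound_piece v
  refine ⟨∑ κ, C κ, fun x => (norm_sum_le _ _).trans (Finset.sum_le_sum fun κ _ => ?_)⟩
  rw [norm_smul]
  by_cases hx : ∃ ν, IsOuterNormal (κ : Set (E N)) x ν
  · obtain ⟨ν, hν⟩ := hx
    have hxκ : x ∈ (κ : Set (E N)) := (isClosed_cell κ).frontier_subset hν.mem_frontier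
    calc _ ≤ C κ * 1 := mul_le_mul (hC κ x hxκ) (norm_outerNormal_le _ x) (norm_nonneg _) (hC0 κ)
      _ = C κ := mul_one _
  · rw [outerNormal, dif_neg hx, norm_zero, mul_zero]; exact hC0 κ

theorem disjoint_interior_cell {κ κ' : T.cells} (hne : κ ≠ κ') :
    Disjoint (interior (κ : Set (E N))) (κ' : Set (E N)) := by
  have h1 := T.disjoint_interior κ κ.2 κ' κ'.2 (fun h => hne (Subtype.ext h))
  have h2 := h1.closure_right isOpen_interior
  rwa [(T.isPolyhedron κ' κ'.2).closure_interior] at h2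

theorem surfaceMeasure_interiorFaces_lt_top (T : Mesh Ω h) : surfaceMeasure N T.interiorFaces < ∞ := by
  have hsub : T.interiorFaces ⊆ ⋃ κ ∈ T.cells, frontier κ := by
    rintro x ⟨e, ⟨he | he, hd⟩, hx⟩
    · obtain ⟨κ, hκ, κ', hκ', hne, rfl, -⟩ := he
      refine mem_biUnion (show κ ∈ (T.cells : Set (Set (E N))) from hκ) ⟨subset_closure hx.1, ?_⟩
      intro hi
      have hne' : (⟨κ, hκ⟩ : T.cells) ≠ ⟨κ', hκ'⟩ := fun h => hne (congrArg Subtype.val h)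
      exact (disjoint_left.1 (disjoint_interior_cell hne')) hi hx.2
    · obtain ⟨κ, hκ, rfl, hdim⟩ := he
      rw [inter_assoc, inter_self, hdim] at hd
      exact absurd hd (lt_irrefl _)
  refine (measure_mono hsub).trans_lt (measure_biUnion_lt_top T.cells.finite_toSet fun κ hκ => ?_)
  exact (T.isPolyhedron κ hκ).surfaceMeasure_frontier_lt_top

theorem integrable_inner {μ : Measure (E N)} [IsFiniteMeasure μ] {f g : E N → E N}
    (hf : Measurable f) (hg : Measurable g) (hfb : ∃ C, ∀ x, ‖f x‖ ≤ C) (hgb : ∃ C, ∀ x, ‖g x‖ ≤ C) :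
    Integrable (fun x => ⟪f x, g x⟫) μ := by
  obtain ⟨C, hC⟩ := hfb
  obtain ⟨D, hD⟩ := hgb
  refine Integrable.of_bound (hf.inner hg).aestronglyMeasurable (C * D) (ae_of_all _ fun x => ?_)
  exact (norm_inner_le_norm _ _).trans
    (mul_le_mul (hC x) (hD x) (norm_nonneg _) ((norm_nonneg _).trans (hC x)))

theorem isFiniteMeasure_domain (T : Mesh Ω h) : IsFiniteMeasure ((volume : Measure (E N)).restrict Ω) :=
  ⟨by
    rw [Measure.restrict_apply_univ]
    exact (T.domain.closure_isPolyhedron.isCompact.isBounded.subset subset_closure).measure_lt_top⟩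

theorem isFiniteMeasure_interiorFaces (T : Mesh Ω h) :
    IsFiniteMeasure ((surfaceMeasure N).restrict T.interiorFaces) :=
  ⟨by rw [Measure.restrict_apply_univ]; exact T.surfaceMeasure_interiorFaces_lt_top⟩

theorem piece_add (v w : T.PolySpace k) (κ : T.cells) (x : E N) :
    piece (v + w) κ x = piece v κ x + piece w κ x := by simp [piece]

theorem piece_smul (c : ℝ) (v : T.PolySpace k) (κ : T.cells) (x : E N) :
    piece (c • v) κ x = c * piece v κ x := by simp [piece, MvPolynomial.smul_eval]

theorem val_add (v w : T.PolySpace k) (x : E N) : val (v + w) x = val v x + val w x := by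
  rw [val, val, val, ← add_div, ← Finset.sum_add_distrib]
  congr 1
  refine Finset.sum_congr rfl fun κ _ => ?_
  by_cases hx : x ∈ (κ : Set (E N)) <;> simp [hx, piece_add]

theorem val_smul (c : ℝ) (v : T.PolySpace k) (x : E N) : val (c • v) x = c * val v x := by
  rw [val, val, ← mul_div_assoc, Finset.mul_sum]
  congr 1
  refine Finset.sum_congr rfl fun κ _ => ?_
  by_cases hx : x ∈ (κ : Set (E N)) <;> simp [hx, piece_smul]

theorem vecVal_add (φ ψ : T.VecSpace l) (x : E N) :
    vecVal (φ + ψ) x = vecVal φ x + vecVal ψ x := by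
  ext i; simp [vecVal, val_add]

theorem vecVal_smul (c : ℝ) (φ : T.VecSpace l) (x : E N) :
    vecVal (c • φ) x = c • vecVal φ x := by
  ext i; simp [vecVal, val_smul]

theorem val_eq_piece (v : T.PolySpace k) (κ : T.cells) {x : E N}
    (hx : x ∈ interior (κ : Set (E N))) : val v x = piece v κ x := by
  have h : ∀ κ' : T.cells, κ' ≠ κ → x ∉ (κ' : Set (E N)) := fun κ' hne =>
    disjoint_left.1 (disjoint_interior_cell hne.symm) hx
  have hxκ := interior_subset hx
  rw [val, Finset.sum_eq_single κ (fun κ' _ hne => indicator_of_notMem (h κ' hne) _) (by simp),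
    Finset.sum_eq_single κ (fun κ' _ hne => indicator_of_notMem (h κ' hne) _) (by simp),
    indicator_of_mem hxκ, indicator_of_mem hxκ, div_one]

theorem interior_cell_subset (κ : T.cells) : interior (κ : Set (E N)) ⊆ Ω := by
  have h1 : (κ : Set (E N)) ⊆ closure Ω := by
    rw [← T.iUnion_cells]
    exact subset_biUnion_of_mem (u := fun κ : Set (E N) => κ) κ.2
  exact (interior_mono h1).trans T.domain.interior_closure.subset

theorem eq_zero_of_eval_eq_zero {p : MvPolynomial (Fin N) ℝ} {U : Set (E N)} (hU : IsOpen U)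
    (hne : U.Nonempty) (h : ∀ x ∈ U, MvPolynomial.eval (fun i => x i) p = 0) : p = 0 := by
  obtain ⟨x, hx⟩ := hne
  have hpre : IsOpen ((fun y : Fin N → ℝ => (WithLp.toLp 2 y : E N)) ⁻¹' U) :=
    hU.preimage (PiLp.continuous_toLp 2 _)
  obtain ⟨ε, hε, hball⟩ := Metric.isOpen_iff.1 hpre (fun i => x i) hx
  refine MvPolynomial.funext_set (fun i => Metric.ball (x i) ε) (fun i => ?_) fun y hy => ?_
  · rw [Real.ball_eq_Ioo]
    exact Ioo_infinite (by linarith)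
  · rw [map_zero]
    refine h (WithLp.toLp 2 y) (hball ?_)
    rw [← ball_pi _ hε] at *
    exact hy

theorem eq_zero_of_inner2_self {q : T.VecSpace l} (hq : inner2 q q = 0) : q = 0 := by
  have := T.isFiniteMeasure_domain
  have hae : ∀ᵐ x ∂(volume.restrict Ω), ⟪vecVal q x, vecVal q x⟫ = 0 := by
    have h1 := (integral_eq_zero_iff_of_nonneg (μ := volume.restrict Ω)
      (f := fun x => ⟪vecVal q x, vecVal q x⟫) (fun x => real_inner_self_nonneg)
      (integrable_inner (measurable_vecVal q) (measurable_vecVal q)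
        (exists_bound_vecVal q) (exists_bound_vecVal q))).1 hq
    exact h1
  funext i κ
  have hae2 : ∀ᵐ x ∂(volume.restrict (interior (κ : Set (E N)))), piece (q i) κ x = 0 := by
    have h2 := ae_restrict_of_ae_restrict_of_subset (interior_cell_subset κ) hae
    filter_upwards [h2, ae_restrict_mem isOpen_interior.measurableSet] with x hx hxκ
    have h3 : vecVal q x = 0 := inner_self_eq_zero.1 hx
    have h4 : vecVal q x i = 0 := by rw [h3]; rfl
    rw [← val_eq_piece (q i) κ hxκ]
    exact h4
  have hzero : EqOn (piece (q i) κ) (fun _ => 0) (interior (κ : Set (E N))) :=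
    Measure.eqOn_open_of_ae_eq hae2 isOpen_interior (continuous_piece _ _).continuousOn
      continuousOn_const
  have hne : (interior (κ : Set (E N))).Nonempty := by
    have h5 := T.isPolyhedron κ κ.2
    rw [← closure_nonempty_iff, h5.closure_interior]
    exact h5.nonempty
  exact Subtype.ext (eq_zero_of_eval_eq_zero isOpen_interior hne hzero)

/-- `q = R(v)`: the defining equation `∫_Ω ⟪q, φ⟫ = -∫_{Γ_int} ⟪[v], {φ}⟫ dS` of the lifting. -/
def IsLifting (v : T.PolySpace k) (q : T.VecSpace l) : Prop :=
  ∀ φ : T.VecSpace l,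
    ∫ x in Ω, ⟪vecVal q x, vecVal φ x⟫ =
      -∫ x in T.interiorFaces, ⟪jump v x, vecVal φ x⟫ ∂(surfaceMeasure N)

theorem existsUnique_isLifting (l : ℕ) (v : T.PolySpace k) :
    ∃! q : T.VecSpace l, IsLifting v q := by
  have hfin1 := T.isFiniteMeasure_domain
  have hfin2 := T.isFiniteMeasure_interiorFaces
  have hint (q φ : T.VecSpace l) :
      Integrable (fun x => ⟪vecVal q x, vecVal φ x⟫) (volume.restrict Ω) :=
    integrable_inner (measurable_vecVal q) (measurable_vecVal φ) (exists_bound_vecVal q)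
      (exists_bound_vecVal φ)
  have hint' (φ : T.VecSpace l) : Integrable (fun x => ⟪jump v x, vecVal φ x⟫)
      ((surfaceMeasure N).restrict T.interiorFaces) :=
    integrable_inner (measurable_jump v) (measurable_vecVal φ) (exists_bound_jump v)
      (exists_bound_vecVal φ)
  let A : T.VecSpace l →ₗ[ℝ] T.VecSpace l →ₗ[ℝ] ℝ := LinearMap.mk₂ ℝ inner2
    (fun q q' φ => by
      simp only [inner2, vecVal_add, inner_add_left]; exact integral_add (hint _ _) (hint _ _))
    (fun c q φ => by
      simp only [inner2, vecVal_smul, real_inner_smul_left]; exact integral_const_mul _ _)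
    (fun q φ φ' => by
      simp only [inner2, vecVal_add, inner_add_right]; exact integral_add (hint _ _) (hint _ _))
    (fun c q φ => by
      simp only [inner2, vecVal_smul, real_inner_smul_right]; exact integral_const_mul _ _)
  let ell : T.VecSpace l →ₗ[ℝ] ℝ :=
    { toFun := fun φ => -∫ x in T.interiorFaces, ⟪jump v x, vecVal φ x⟫ ∂(surfaceMeasure N)
      map_add' := fun φ φ' => by
        simp only [vecVal_add, inner_add_right]
        rw [integral_add (hint' _) (hint' _), neg_add]
      map_smul' := fun c φ => by
        simp only [vecVal_smul, real_inner_smul_right]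
        rw [integral_const_mul]; simp }
  have hinj : Function.Injective A := by
    rw [← LinearMap.ker_eq_bot, LinearMap.ker_eq_bot']
    intro q hq
    exact eq_zero_of_inner2_self (show A q q = 0 by rw [hq]; rfl)
  have hsurj : Function.Surjective A :=
    (LinearMap.injective_iff_surjective_of_finrank_eq_finrank
      (Subspace.dual_finrank_eq (K := ℝ) (V := T.VecSpace l)).symm).1 hinj
  obtain ⟨q, hq⟩ := hsurj ell
  refine ⟨q, fun φ => LinearMap.congr_fun hq φ, fun q' hq' => hinj ?_⟩
  rw [hq]
  exact LinearMap.ext hq'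

variable (l) in
/-- The lifting operator `R : S^k(T) → S^l(T)^N`. -/
def lifting (v : T.PolySpace k) : T.VecSpace l := (existsUnique_isLifting l v).choose

theorem isLifting_lifting (v : T.PolySpace k) : IsLifting v (lifting l v) :=
  (existsUnique_isLifting l v).choose_spec.1

/-! ### The functionals, the augmented Lagrangian and the algorithm -/

/-- `B v = R(v) + ∇v`. -/
def opB (hkl : k ≤ l + 1) (v : T.PolySpace k) : T.VecSpace l := lifting l v + grad hkl v

/-- `F(q) = ∫_Ω |q|^{p(x)} dx`. -/
def funF (p : E N → ℝ) (q : T.VecSpace l) : ℝ := ∫ x in Ω, ‖vecVal q x‖ ^ p x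

variable (T) in
/-- The weight `𝐡(x)^{-2/p'(x)}`, where `p' = p / (p - 1)` is the conjugate exponent. -/
def weight (p : E N → ℝ) (x : E N) : ℝ := T.localSize x ^ (-2 / (p x / (p x - 1)))

/-- `G(v) = ∫_Ω |v-ξ|² dx + ∫_{Γ_int} |[v]|² 𝐡^{-2/p'(x)} dS + ∫_{∂Ω} |v-u_D|² 𝐡^{-2/p'(x)} dS`. -/
def funG (p ξ uD : E N → ℝ) (v : T.PolySpace k) : ℝ :=
  (∫ x in Ω, |val v x - ξ x| ^ 2) +
    (∫ x in T.interiorFaces, ‖jump v x‖ ^ 2 * T.weight p x ∂(surfaceMeasure N)) +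
    ∫ x in frontier Ω, |val v x - uD x| ^ 2 * T.weight p x ∂(surfaceMeasure N)

/-- The augmented Lagrangian `L_r(v, q, μ) = F(q) + G(v) + ⟨μ, Bv - q⟩ + (r/2) ‖Bv - q‖²`. -/
def lagrangian (p ξ uD : E N → ℝ) (hkl : k ≤ l + 1) (r : ℝ) (v : T.PolySpace k)
    (q μ : T.VecSpace l) : ℝ :=
  funF p q + funG p ξ uD v + inner2 μ (opB hkl v - q) +
    r / 2 * inner2 (opB hkl v - q) (opB hkl v - q)

/-- `(u, η, lam)` is a saddle point of `L_r`. -/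
def IsSaddlePoint (p ξ uD : E N → ℝ) (hkl : k ≤ l + 1) (r : ℝ) (u : T.PolySpace k)
    (η lam : T.VecSpace l) : Prop :=
  ∀ (v : T.PolySpace k) (q μ : T.VecSpace l),
    lagrangian p ξ uD hkl r u η μ ≤ lagrangian p ξ uD hkl r u η lam ∧
      lagrangian p ξ uD hkl r u η lam ≤ lagrangian p ξ uD hkl r v q lam

/-- The sequences produced by Algorithm 1 with step sizes `ρ n` (and the initial multiplier `lam 0`):
`(u n, η n)` minimizes `L_r(·, ·, lam n)`, and `lam (n+1) = lam n + ρ n (B (u n) - η n)`. -/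
structure IsAlgorithm1 (p ξ uD : E N → ℝ) (hkl : k ≤ l + 1) (r : ℝ) (ρ : ℕ → ℝ)
    (u : ℕ → T.PolySpace k) (η lam : ℕ → T.VecSpace l) : Prop where
  minimizes : ∀ (n : ℕ) (v : T.PolySpace k) (q : T.VecSpace l),
    lagrangian p ξ uD hkl r (u n) (η n) (lam n) ≤ lagrangian p ξ uD hkl r v q (lam n)
  update : ∀ n : ℕ, lam (n + 1) = lam n + ρ n • (opB hkl (u n) - η n)

/-! ### The `L²` norms of the conclusion -/

/-- The norm of `V`, that is, of `L²(Ω)`. -/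
def normV (v : T.PolySpace k) : ℝ≥0∞ := eLpNorm (val v) 2 (volume.restrict Ω)

/-- The norm of `H`, that is, of `L²(Ω)^N`. -/
def normH (q : T.VecSpace l) : ℝ≥0∞ := eLpNorm (vecVal q) 2 (volume.restrict Ω)

/-- The norm of the jump of `v` in `L²(Γ_int)`. -/
def normJump (v : T.PolySpace k) : ℝ≥0∞ :=
  eLpNorm (jump v) 2 ((surfaceMeasure N).restrict T.interiorFaces)

/-- The norm of the trace of `v` in `L²(∂Ω)`. -/
def normTrace (v : T.PolySpace k) : ℝ≥0∞ :=
  eLpNorm (val v) 2 ((surfaceMeasure N).restrict (frontier Ω))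

end Mesh

/-- `p` is log-Hölder continuous on `S`. -/
def LogHolderOn {N : ℕ} (p : E N → ℝ) (S : Set (E N)) : Prop :=
  ∃ C : ℝ, ∀ x ∈ S, ∀ y ∈ S, |p x - p y| ≤ C / Real.log (Real.exp 1 + 1 / ‖x - y‖)

end DG

end

open MeasureTheory Filter Topology Set
open scoped ENNReal RealInnerProductSpace

noncomputable section

namespace DG

/-! ### Augmented Lagrangian methods for convex problems -/

section Abstract

variable {V H X Y : Type*} [AddCommGroup V] [Module ℝ V] [AddCommGroup H] [Module ℝ H]
  [NormedAddCommGroup X] [InnerProductSpace ℝ X] [NormedAddCommGroup Y] [NormedSpace ℝ Y]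

/-! The iteration is an Uzawa method, and its convergence is an energy argument for the multipliers.
Write `e n = B (un n) - ηn n`. Moving a short way along a segment from a minimizer of the augmented
Lagrangian gives a variational inequality (`variational_inequality_of_minimizes`). It carries the
extra term `‖v - u‖²`, because `G` contains `∫ |v - ξ|²` and is therefore strongly convex in the
`L²` norm (`funG_combo_le`); `F` is merely convex (`funF_combo_le`).

Test the inequality of the saddle point with the iterate and that of the iterate with the saddle
point, and add. `F` and `G` cancel, and since `η = B u` what remains is `2‖un n - u‖² + r‖e n‖² +
⟪lamn n - lam, e n⟫ ≤ 0`. Inserted in the expansion of `‖lamn (n+1) - lam‖²`, this shows that the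
squared distance to `lam` drops by at least `ρ n (2r - ρ n)‖e n‖² + 4 ρ n ‖un n - u‖²`. The step
size bounds keep both coefficients away from zero, so the multipliers stay bounded and both `un n -
u` and `e n` tend to zero (`tendsto_of_augmentedLagrangian`).

The mesh is fixed and `V` is finite-dimensional, and a piecewise polynomial that vanishes almost
everywhere is zero (`valL2_injective`). Hence `L²` convergence of `un n - u` carries over to all its
linear images: jump, trace, lifting and gradient (`tendsto_zero_of_injective`).

In the abstract part `V` and `H` are bare vector spaces, measured through linear maps `jV` and `jH`;
these become the embeddings into `L²`. -/

theorem nonneg_of_forall_add_mul_nonneg {a b : ℝ} (hab : ∀ t : ℝ, 0 < t → t ≤ 1 → 0 ≤ a + t * b) :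
    0 ≤ a := by
  have hlim : Tendsto (fun t : ℝ => a + t * b) (𝓝[>] 0) (𝓝 a) := by
    have : Continuous fun t : ℝ => a + t * b := by fun_prop
    simpa using (this.tendsto 0).mono_left nhdsWithin_le_nhds
  refine ge_of_tendsto hlim ?_
  filter_upwards [Ioc_mem_nhdsGT (zero_lt_one' ℝ)] with t ht using hab t ht.1 ht.2

/-- The variational inequality satisfied by the minimizers of the augmented Lagrangian. -/
theorem variational_inequality_of_minimizes (jH : H →ₗ[ℝ] X) (jV : V →ₗ[ℝ] Y) (B : V →ₗ[ℝ] H)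
    {F : H → ℝ} {G : V → ℝ}
    (hF : ∀ (q q' : H) (t : ℝ), 0 ≤ t → t ≤ 1 →
      F (q + t • (q' - q)) ≤ (1 - t) * F q + t * F q')
    (hG : ∀ (v v' : V) (t : ℝ), 0 ≤ t → t ≤ 1 →
      G (v + t • (v' - v)) ≤ (1 - t) * G v + t * G v' - t * (1 - t) * ‖jV (v' - v)‖ ^ 2)
    {r : ℝ} {u : V} {η lam : H}
    (hmin : ∀ v q, F η + G u + ⟪jH lam, jH (B u - η)⟫ + r / 2 * ‖jH (B u - η)‖ ^ 2 ≤
      F q + G v + ⟪jH lam, jH (B v - q)⟫ + r / 2 * ‖jH (B v - q)‖ ^ 2) (v : V) (q : H) :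
    ‖jV (v - u)‖ ^ 2 ≤ F q - F η + (G v - G u) +
      ⟪jH lam + r • jH (B u - η), jH (B v - q) - jH (B u - η)⟫ := by
  set e := jH (B u - η) with he
  set d := jH (B v - q) - e with hd
  rw [← sub_nonneg]
  -- Compare with the point at parameter `t` on the segment to `(v, q)`, divide by `t` and let `t →
  -- 0`. The coefficient `b` collects what is of second order in `t`: the `t²` part of `t(1 - t)‖jV
  -- (v - u)‖²` and the square of the penalty.
  refine nonneg_of_forall_add_mul_nonneg
    (b := ‖jV (v - u)‖ ^ 2 + r / 2 * ‖d‖ ^ 2) fun t ht0 ht1 => ?_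
  have h1 := hmin (u + t • (v - u)) (η + t • (q - η))
  have h2 : jH (B (u + t • (v - u)) - (η + t • (q - η))) = e + t • d := by
    rw [hd, he]; simp only [map_add, map_sub, map_smul]; module
  have h3 := hF η q t ht0.le ht1
  have h4 := hG u v t ht0.le ht1
  have h5 : ‖e + t • d‖ ^ 2 = ‖e‖ ^ 2 + 2 * t * ⟪e, d⟫ + t ^ 2 * ‖d‖ ^ 2 := by
    rw [norm_add_sq_real, real_inner_smul_right, norm_smul, mul_pow, Real.norm_eq_abs, sq_abs]
    ring
  rw [h2, h5, inner_add_right, real_inner_smul_right] at h1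
  rw [inner_add_left, real_inner_smul_left]
  refine nonneg_of_mul_nonneg_right (a := t) ?_ ht0
  nlinarith

/-- The sequence `a` decreases and is bounded below, so its increments tend to zero, and they
dominate `c * b n`. -/
theorem tendsto_zero_of_add_mul_le {a b : ℕ → ℝ} {c : ℝ} (hc : 0 < c) (ha : ∀ n, 0 ≤ a n)
    (hb : ∀ n, 0 ≤ b n) (hab : ∀ n, a (n + 1) + c * b n ≤ a n) : Tendsto b atTop (𝓝 0) := by
  have hanti : Antitone a := antitone_nat_of_succ_le fun n => by
    nlinarith [hab n, mul_nonneg hc.le (hb n)]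
  have hlim := tendsto_atTop_ciInf hanti ⟨0, by rintro _ ⟨n, rfl⟩; exact ha n⟩
  have hdiff : Tendsto (fun n => (a n - a (n + 1)) / c) atTop (𝓝 0) := by
    simpa using (hlim.sub (hlim.comp (tendsto_add_atTop_nat 1))).div_const c
  refine squeeze_zero hb (fun n => ?_) hdiff
  rw [le_div_iff₀ hc]
  linarith [hab n, mul_comm c (b n)]

/-- Convergence of the augmented Lagrangian (Uzawa) iteration: the primal variable and the
constraint violation converge, and the multipliers are Fejér monotone. -/
theorem tendsto_of_augmentedLagrangian (jH : H →ₗ[ℝ] X) (jV : V →ₗ[ℝ] Y) (B : V →ₗ[ℝ] H)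
    {F : H → ℝ} {G : V → ℝ}
    (hF : ∀ (q q' : H) (t : ℝ), 0 ≤ t → t ≤ 1 →
      F (q + t • (q' - q)) ≤ (1 - t) * F q + t * F q')
    (hG : ∀ (v v' : V) (t : ℝ), 0 ≤ t → t ≤ 1 →
      G (v + t • (v' - v)) ≤ (1 - t) * G v + t * G v' - t * (1 - t) * ‖jV (v' - v)‖ ^ 2)
    {r : ℝ} {u : V} {η lam : H} (hη : η = B u)
    (hmin : ∀ v q, F η + G u + ⟪jH lam, jH (B u - η)⟫ + r / 2 * ‖jH (B u - η)‖ ^ 2 ≤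
      F q + G v + ⟪jH lam, jH (B v - q)⟫ + r / 2 * ‖jH (B v - q)‖ ^ 2)
    {ρ : ℕ → ℝ} {α₀ α₁ : ℝ} (hα₀ : 0 < α₀) (hα₁ : α₁ < 2 * r) (hρ : ∀ n, α₀ ≤ ρ n ∧ ρ n ≤ α₁)
    {un : ℕ → V} {ηn lamn : ℕ → H}
    (hminn : ∀ n v q,
      F (ηn n) + G (un n) + ⟪jH (lamn n), jH (B (un n) - ηn n)⟫ +
        r / 2 * ‖jH (B (un n) - ηn n)‖ ^ 2 ≤
      F q + G v + ⟪jH (lamn n), jH (B v - q)⟫ + r / 2 * ‖jH (B v - q)‖ ^ 2)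
    (hupd : ∀ n, lamn (n + 1) = lamn n + ρ n • (B (un n) - ηn n)) :
    Tendsto (fun n => jV (un n - u)) atTop (𝓝 0) ∧
    Tendsto (fun n => jH (B (un n) - ηn n)) atTop (𝓝 0) ∧
    ∀ n, ‖jH (lamn n - lam)‖ ≤ ‖jH (lamn 0 - lam)‖ := by
  set e : ℕ → X := fun n => jH (B (un n) - ηn n) with he
  -- Each of the two minimizers serves as the competitor in the inequality of the other. The
  -- constraint residual of the saddle point is zero, so only `e n` survives in the inner products.
  have hmono (n : ℕ) : 2 * ‖jV (un n - u)‖ ^ 2 + r * ‖e n‖ ^ 2 + ⟪jH (lamn n - lam), e n⟫ ≤ 0 := by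
    have h1 := variational_inequality_of_minimizes jH jV B hF hG hmin (un n) (ηn n)
    have h2 := variational_inequality_of_minimizes jH jV B hF hG (hminn n) u η
    have h3 : ‖jV (u - un n)‖ = ‖jV (un n - u)‖ := by rw [← neg_sub, map_neg, norm_neg]
    have h4 : jH (B u - η) = 0 := by rw [hη, sub_self, map_zero]
    simp only [h4, smul_zero, add_zero, sub_zero, zero_sub, inner_neg_right, inner_add_left,
      real_inner_smul_left, real_inner_self_eq_norm_sq, h3] at h1 h2
    rw [map_sub jH, inner_sub_left]
    linarith
  have hfejer (n : ℕ) : ‖jH (lamn (n + 1) - lam)‖ ^ 2 + α₀ * (2 * r - α₁) * ‖e n‖ ^ 2 +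
      4 * α₀ * ‖jV (un n - u)‖ ^ 2 ≤ ‖jH (lamn n - lam)‖ ^ 2 := by
    have h1 : jH (lamn (n + 1) - lam) = jH (lamn n - lam) + ρ n • e n := by
      rw [hupd, he]; simp only [map_add, map_sub, map_smul]; module
    have h2 := hmono n
    obtain ⟨h3, h4⟩ := hρ n
    -- Bounding the two factors separately avoids any discussion of where `s ↦ s (2r - s)` is
    -- monotone.
    have h5 : α₀ * (2 * r - α₁) ≤ ρ n * (2 * r - ρ n) :=
      mul_le_mul h3 (by linarith) (by linarith) (by linarith)
    have h6 := mul_le_mul_of_nonneg_right h5 (sq_nonneg ‖e n‖)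
    have h7 := mul_le_mul_of_nonneg_right h3 (sq_nonneg ‖jV (un n - u)‖)
    have h8 := mul_nonneg (hα₀.le.trans h3) (neg_nonneg.2 h2)
    rw [h1, norm_add_sq_real, real_inner_smul_right, norm_smul, mul_pow, Real.norm_eq_abs, sq_abs]
    nlinarith
  have hc : 0 < α₀ * (2 * r - α₁) := mul_pos hα₀ (by linarith)
  refine ⟨?_, ?_, ?_⟩
  · have := tendsto_zero_of_add_mul_le (a := fun n => ‖jH (lamn n - lam)‖ ^ 2)
      (b := fun n => ‖jV (un n - u)‖ ^ 2) (c := 4 * α₀) (by positivity) (fun n => sq_nonneg _)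
      (fun n => sq_nonneg _) fun n => by nlinarith [hfejer n, mul_nonneg hc.le (sq_nonneg ‖e n‖)]
    rw [tendsto_zero_iff_norm_tendsto_zero]
    simpa [Real.sqrt_sq] using this.sqrt
  · have := tendsto_zero_of_add_mul_le (a := fun n => ‖jH (lamn n - lam)‖ ^ 2)
      (b := fun n => ‖e n‖ ^ 2) hc (fun n => sq_nonneg _)
      (fun n => sq_nonneg _) fun n => by
        nlinarith [hfejer n, mul_nonneg hα₀.le (sq_nonneg ‖jV (un n - u)‖)]
    rw [tendsto_zero_iff_norm_tendsto_zero]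
    simpa [Real.sqrt_sq] using this.sqrt
  · have hanti : Antitone fun n => ‖jH (lamn n - lam)‖ := antitone_nat_of_succ_le fun n => by
      refine (sq_le_sq₀ (norm_nonneg _) (norm_nonneg _)).1 ?_
      nlinarith [hfejer n, mul_nonneg hc.le (sq_nonneg ‖e n‖),
        mul_nonneg hα₀.le (sq_nonneg ‖jV (un n - u)‖)]
    exact fun n => hanti (Nat.zero_le n)

/-- On a finite-dimensional space, an injective linear map to a normed space controls all the
others. -/
theorem tendsto_zero_of_injective {W : Type*} [NormedAddCommGroup W] [NormedSpace ℝ W]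
    [FiniteDimensional ℝ V] {j : V →ₗ[ℝ] Y} (hj : Function.Injective j) (Φ : V →ₗ[ℝ] W)
    {v : ℕ → V} (hv : Tendsto (fun n => j (v n)) atTop (𝓝 0)) :
    Tendsto (fun n => Φ (v n)) atTop (𝓝 0) := by
  -- `V` has no topology of its own; the one used is that of the range of `j`, on which every linear
  -- map is continuous by finite dimension.
  let ε := LinearEquiv.ofInjective j hj
  have hcont := (Φ ∘ₗ ε.symm.toLinearMap).continuous_of_finiteDimensional
  have h1 : Tendsto (fun n => ε (v n)) atTop (𝓝 0) := by
    rw [tendsto_subtype_rng]; exact hv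
  simpa [Function.comp_def] using (hcont.tendsto 0).comp h1

end Abstract

/-! ### Linear families of square integrable functions -/

/-- The linear map to `L²` given by functions that depend linearly on a parameter. -/
def toL2 {V α F : Type*} [AddCommGroup V] [Module ℝ V] [MeasurableSpace α] [NormedAddCommGroup F]
    [NormedSpace ℝ F] {μ : Measure α} (f : V → α → F) (hmem : ∀ v, MemLp (f v) 2 μ)
    (hadd : ∀ v w, f (v + w) = f v + f w) (hsmul : ∀ (c : ℝ) v, f (c • v) = c • f v) :
    V →ₗ[ℝ] Lp F 2 μ where
  toFun v := (hmem v).toLp (f v)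
  map_add' v w := by
    rw [← MemLp.toLp_add]; congr 1; exact hadd v w
  map_smul' c v := by
    rw [RingHom.id_apply, ← MemLp.toLp_const_smul]; congr 1; exact hsmul c v

theorem tendsto_toL2_iff {V α F : Type*} [AddCommGroup V] [Module ℝ V] [MeasurableSpace α]
    [NormedAddCommGroup F] [NormedSpace ℝ F] {μ : Measure α} {f : V → α → F}
    {hmem : ∀ v, MemLp (f v) 2 μ} {hadd : ∀ v w, f (v + w) = f v + f w}
    {hsmul : ∀ (c : ℝ) v, f (c • v) = c • f v} {v : ℕ → V} :
    Tendsto (fun n => toL2 f hmem hadd hsmul (v n)) atTop (𝓝 0) ↔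
      Tendsto (fun n => eLpNorm (f (v n)) 2 μ) atTop (𝓝 0) := by
  rw [tendsto_zero_iff_norm_tendsto_zero, ← ENNReal.tendsto_toReal_iff
    (fun n => (hmem (v n)).2.ne) ENNReal.zero_ne_top]
  simp [toL2, Lp.norm_toLp]

/-! ### Continuity of the exponent -/

/-- The logarithm in the modulus blows up as the points merge. Continuity supplies the measurability
of `p` behind all the integrals with variable exponents. -/
theorem LogHolderOn.continuousOn {N : ℕ} {p : E N → ℝ} {S : Set (E N)} (hp : LogHolderOn p S) :
    ContinuousOn p S := by
  obtain ⟨C, hC⟩ := hp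
  intro x hx
  -- The centre has to be removed: there `1 / 0 = 0`, and the modulus takes the value `C` instead of
  -- something small.
  rw [← continuousWithinAt_sdiff_self]
  have h1 : Tendsto (fun y => ‖y - x‖) (𝓝[S \ {x}] x) (𝓝[>] 0) := by
    rw [tendsto_nhdsWithin_iff]
    constructor
    · have : Continuous fun y : E N => ‖y - x‖ := by fun_prop
      simpa using (this.tendsto x).mono_left nhdsWithin_le_nhds
    · filter_upwards [self_mem_nhdsWithin] with y hy
      exact norm_pos_iff.2 (sub_ne_zero.2 hy.2)
  have h2 : Tendsto (fun y => C / Real.log (Real.exp 1 + 1 / ‖y - x‖)) (𝓝[S \ {x}] x) (𝓝 0) := by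
    refine Tendsto.const_div_atTop (Real.tendsto_log_atTop.comp ?_) C
    simp only [one_div]
    exact tendsto_atTop_add_const_left _ _ (tendsto_inv_nhdsGT_zero.comp h1)
  rw [ContinuousWithinAt, tendsto_iff_norm_sub_tendsto_zero]
  refine squeeze_zero' (Eventually.of_forall fun y => norm_nonneg _) ?_ h2
  filter_upwards [self_mem_nhdsWithin] with y hy using hC y hy.1 x hx

namespace Mesh

variable {N : ℕ} {Ω : Set (E N)} {h : ℝ} {T : Mesh Ω h} {k l : ℕ}

/-! ### Linearity -/

theorem jump_add (v w : T.PolySpace k) (x : E N) : jump (v + w) x = jump v x + jump w x := by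
  simp only [jump, piece_add, add_smul, Finset.sum_add_distrib]

theorem jump_smul (c : ℝ) (v : T.PolySpace k) (x : E N) : jump (c • v) x = c • jump v x := by
  simp only [jump, piece_smul, mul_smul, Finset.smul_sum]

theorem integrable_jump_inner (v : T.PolySpace k) (φ : T.VecSpace l) :
    Integrable (fun x => ⟪jump v x, vecVal φ x⟫)
      ((surfaceMeasure N).restrict T.interiorFaces) :=
  have := T.isFiniteMeasure_interiorFaces
  integrable_inner (measurable_jump v) (measurable_vecVal φ) (exists_bound_jump v)
    (exists_bound_vecVal φ)

theorem integrable_vecVal_inner (q φ : T.VecSpace l) :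
    Integrable (fun x => ⟪vecVal q x, vecVal φ x⟫) (volume.restrict Ω) :=
  have := T.isFiniteMeasure_domain
  integrable_inner (measurable_vecVal q) (measurable_vecVal φ) (exists_bound_vecVal q)
    (exists_bound_vecVal φ)

variable (T k l) in
/-- The lifting operator as a linear map. -/
def liftingMap : T.PolySpace k →ₗ[ℝ] T.VecSpace l where
  toFun := lifting l
  map_add' v w := by
    -- Linearity comes from uniqueness: the sum of the liftings solves the equation that defines the
    -- lifting of the sum.
    refine (existsUnique_isLifting l (v + w)).unique (isLifting_lifting _) fun φ => ?_
    simp only [vecVal_add, jump_add, inner_add_left]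
    rw [integral_add (integrable_vecVal_inner _ _) (integrable_vecVal_inner _ _),
      integral_add (integrable_jump_inner _ _) (integrable_jump_inner _ _),
      isLifting_lifting v φ, isLifting_lifting w φ, neg_add]
  map_smul' c v := by
    refine (existsUnique_isLifting l (c • v)).unique (isLifting_lifting _) fun φ => ?_
    simp only [vecVal_smul, jump_smul, real_inner_smul_left, RingHom.id_apply]
    rw [integral_const_mul, integral_const_mul, isLifting_lifting v φ, mul_neg]

variable (T) in
/-- The broken gradient as a linear map. -/
def gradMap (hkl : k ≤ l + 1) : T.PolySpace k →ₗ[ℝ] T.VecSpace l where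
  toFun := grad hkl
  map_add' v w := by funext i κ; apply Subtype.ext; simp [grad]
  map_smul' c v := by funext i κ; apply Subtype.ext; simp [grad]

variable (T) in
/-- `B v = R(v) + ∇v` as a linear map. -/
def opBMap (hkl : k ≤ l + 1) : T.PolySpace k →ₗ[ℝ] T.VecSpace l := liftingMap T k l + gradMap T hkl

theorem opBMap_apply (hkl : k ≤ l + 1) (v : T.PolySpace k) : opBMap T hkl v = opB hkl v := rfl

/-! ### The embeddings into `L²` -/

/-- Since `Ω` has no slits, `∂Ω` is the boundary of the polyhedron `closure Ω` and so has finite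
surface measure. -/
theorem frontier_closure_domain (T : Mesh Ω h) : frontier (closure Ω) = frontier Ω := by
  rw [frontier, frontier, closure_closure, T.domain.interior_closure, T.domain.isOpen.interior_eq]

theorem isFiniteMeasure_frontier (T : Mesh Ω h) :
    IsFiniteMeasure ((surfaceMeasure N).restrict (frontier Ω)) :=
  ⟨by
    rw [Measure.restrict_apply_univ, ← T.frontier_closure_domain]
    exact T.domain.closure_isPolyhedron.surfaceMeasure_frontier_lt_top⟩

theorem memLp_of_measurable_of_bound {α F : Type*} [MeasurableSpace α] {μ : Measure α}
    [IsFiniteMeasure μ] [NormedAddCommGroup F] [MeasurableSpace F] [BorelSpace F]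
    [SecondCountableTopology F] {f : α → F}
    (hf : Measurable f) (hb : ∃ C, ∀ x, ‖f x‖ ≤ C) {p : ℝ≥0∞} : MemLp f p μ :=
  let ⟨C, hC⟩ := hb
  MemLp.of_bound hf.aestronglyMeasurable C (ae_of_all _ hC)

theorem memLp_val (v : T.PolySpace k) : MemLp (val v) 2 (volume.restrict Ω) :=
  have := T.isFiniteMeasure_domain
  memLp_of_measurable_of_bound (measurable_val v) (exists_bound_val v)

theorem memLp_val_frontier (v : T.PolySpace k) :
    MemLp (val v) 2 ((surfaceMeasure N).restrict (frontier Ω)) :=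
  have := T.isFiniteMeasure_frontier
  memLp_of_measurable_of_bound (measurable_val v) (exists_bound_val v)

theorem memLp_vecVal (q : T.VecSpace l) : MemLp (vecVal q) 2 (volume.restrict Ω) :=
  have := T.isFiniteMeasure_domain
  memLp_of_measurable_of_bound (measurable_vecVal q) (exists_bound_vecVal q)

theorem memLp_jump (v : T.PolySpace k) :
    MemLp (jump v) 2 ((surfaceMeasure N).restrict T.interiorFaces) :=
  have := T.isFiniteMeasure_interiorFaces
  memLp_of_measurable_of_bound (measurable_jump v) (exists_bound_jump v)

variable (T k) in
/-- The embedding of `V` into `L²(Ω)`. -/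
def valL2 : T.PolySpace k →ₗ[ℝ] Lp ℝ 2 (volume.restrict Ω) :=
  toL2 val memLp_val (fun v w => funext (val_add v w)) (fun c v => funext (val_smul c v))

variable (T l) in
/-- The embedding of `H` into `L²(Ω)^N`. -/
def vecValL2 : T.VecSpace l →ₗ[ℝ] Lp (E N) 2 (volume.restrict Ω) :=
  toL2 vecVal memLp_vecVal (fun v w => funext (vecVal_add v w))
    (fun c v => funext (vecVal_smul c v))

variable (T k) in
/-- The jump as a linear map to `L²(Γ_int)`. -/
def jumpL2 : T.PolySpace k →ₗ[ℝ] Lp (E N) 2 ((surfaceMeasure N).restrict T.interiorFaces) :=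
  toL2 jump memLp_jump (fun v w => funext (jump_add v w)) (fun c v => funext (jump_smul c v))

variable (T k) in
/-- The trace as a linear map to `L²(∂Ω)`. -/
def traceL2 : T.PolySpace k →ₗ[ℝ] Lp ℝ 2 ((surfaceMeasure N).restrict (frontier Ω)) :=
  toL2 val memLp_val_frontier (fun v w => funext (val_add v w)) (fun c v => funext (val_smul c v))

theorem inner2_eq (q φ : T.VecSpace l) : inner2 q φ = ⟪vecValL2 T l q, vecValL2 T l φ⟫ := by
  rw [L2.inner_def]
  refine integral_congr_ae ?_
  filter_upwards [(memLp_vecVal q).coeFn_toLp, (memLp_vecVal φ).coeFn_toLp] with x h1 h2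
  simp only [vecValL2, toL2, LinearMap.coe_mk, AddHom.coe_mk, h1, h2]

theorem vecValL2_injective : Function.Injective (vecValL2 T l) := by
  rw [← LinearMap.ker_eq_bot, LinearMap.ker_eq_bot']
  intro q hq
  exact eq_zero_of_inner2_self (by rw [inner2_eq, hq, inner_zero_left])

/-- On the nonempty interior of a cell, `val v` is the polynomial of that cell. Vanishing almost
everywhere there, it vanishes on an open set by continuity, hence identically. -/
theorem valL2_injective : Function.Injective (valL2 T k) := by
  rw [← LinearMap.ker_eq_bot, LinearMap.ker_eq_bot']
  intro v hv
  have hae : ∀ᵐ x ∂(volume.restrict Ω), val v x = 0 := by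
    have h1 : (memLp_val v).toLp (val v) = 0 := hv
    have h2 := (memLp_val v).coeFn_toLp
    rw [h1] at h2
    filter_upwards [h2, Lp.coeFn_zero ℝ 2 (volume.restrict Ω)] with x h3 h4
    rw [← h3, h4, Pi.zero_apply]
  funext κ
  have hae2 : ∀ᵐ x ∂(volume.restrict (interior (κ : Set (E N)))), piece v κ x = 0 := by
    filter_upwards [ae_restrict_of_ae_restrict_of_subset (interior_cell_subset κ) hae,
      ae_restrict_mem isOpen_interior.measurableSet] with x hx hxκ
    rw [← val_eq_piece v κ hxκ, hx]
  have hne : (interior (κ : Set (E N))).Nonempty := by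
    have h5 := T.isPolyhedron κ κ.2
    rw [← closure_nonempty_iff, h5.closure_interior]
    exact h5.nonempty
  exact Subtype.ext (eq_zero_of_eval_eq_zero isOpen_interior hne
    (Measure.eqOn_open_of_ae_eq hae2 isOpen_interior (continuous_piece _ _).continuousOn
      continuousOn_const))

theorem tendsto_vecValL2_iff {q : ℕ → T.VecSpace l} :
    Tendsto (fun n => vecValL2 T l (q n)) atTop (𝓝 0) ↔
      Tendsto (fun n => normH (q n)) atTop (𝓝 0) :=
  tendsto_toL2_iff

theorem norm_vecValL2 (q : T.VecSpace l) : ‖vecValL2 T l q‖ = (normH q).toReal :=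
  Lp.norm_toLp _ (memLp_vecVal q)

theorem norm_valL2_sq (v : T.PolySpace k) : ‖valL2 T k v‖ ^ 2 = ∫ x in Ω, |val v x| ^ 2 := by
  rw [← real_inner_self_eq_norm_sq, L2.inner_def]
  refine integral_congr_ae ?_
  filter_upwards [(memLp_val v).coeFn_toLp] with x h1
  simp only [valL2, toL2, LinearMap.coe_mk, AddHom.coe_mk, h1, real_inner_self_eq_norm_sq,
    Real.norm_eq_abs]

/-! ### The weight -/

theorem finite_faces (T : Mesh Ω h) : T.faces.Finite := by
  refine Finite.union ?_ ?_
  · refine (Finite.image2 (fun a b : Set (E N) => a ∩ b) T.cells.finite_toSet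
      T.cells.finite_toSet).subset ?_
    rintro e ⟨κ, hκ, κ', hκ', -, rfl, -⟩
    exact ⟨κ, hκ, κ', hκ', rfl⟩
  · refine (T.cells.finite_toSet.image fun κ => κ ∩ frontier Ω).subset ?_
    rintro e ⟨κ, hκ, rfl, -⟩
    exact ⟨κ, hκ, rfl⟩

theorem isClosed_of_mem_faces {e : Set (E N)} (he : e ∈ T.faces) : IsClosed e := by
  rcases he with ⟨κ, hκ, κ', hκ', -, rfl, -⟩ | ⟨κ, hκ, rfl, -⟩
  · exact (isClosed_cell ⟨κ, hκ⟩).inter (isClosed_cell ⟨κ', hκ'⟩)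
  · exact (isClosed_cell ⟨κ, hκ⟩).inter isClosed_frontier

theorem localSize_nonneg (x : E N) : 0 ≤ T.localSize x := by
  refine Real.sSup_nonneg ?_
  rintro _ ⟨e, -, -, rfl⟩
  exact Metric.diam_nonneg

/-- Every value is the supremum of a subset of the finite set of face diameters. This bounds the
negative powers of the local size without a lower bound on the diameters. -/
theorem finite_range_localSize (T : Mesh Ω h) : (range T.localSize).Finite := by
  refine ((T.finite_faces.image Metric.diam).finite_subsets.image sSup).subset ?_
  rintro _ ⟨x, rfl⟩
  refine ⟨_, ?_, rfl⟩
  rintro _ ⟨e, he, -, rfl⟩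
  exact ⟨e, he, rfl⟩

theorem measurable_localSize (T : Mesh Ω h) : Measurable T.localSize := by
  have hfin : Finite T.faces := T.finite_faces
  -- A finite supremum of indicators of closed sets is measurable. Faces that miss `x` contribute
  -- zeros, which is harmless because diameters are nonnegative and `sSup ∅ = 0`.
  have key : T.localSize = fun x => ⨆ e : T.faces, (e : Set (E N)).indicator
      (fun _ => Metric.diam (e : Set (E N))) x := by
    funext x
    have hbdd := (finite_range fun e : T.faces => (e : Set (E N)).indicator
      (fun _ => Metric.diam (e : Set (E N))) x).bddAbove
    refine le_antisymm (Real.sSup_le ?_ (Real.iSup_nonneg fun e =>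
      indicator_nonneg (fun _ _ => Metric.diam_nonneg) x))
      (Real.iSup_le (fun e => ?_) (localSize_nonneg x))
    · rintro _ ⟨e, he, hx, rfl⟩
      refine le_trans (le_of_eq ?_) (le_ciSup hbdd ⟨e, he⟩)
      exact (indicator_of_mem hx (fun _ => Metric.diam e)).symm
    · by_cases hx : x ∈ (e : Set (E N))
      · rw [indicator_of_mem hx]
        refine le_csSup ((T.finite_faces.image Metric.diam).subset ?_).bddAbove ⟨e, e.2, hx, rfl⟩
        rintro _ ⟨e, he, -, rfl⟩
        exact ⟨e, he, rfl⟩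
      · rw [indicator_of_notMem hx]; exact localSize_nonneg x
  rw [key]
  exact Measurable.iSup fun e =>
    measurable_const.indicator (isClosed_of_mem_faces e.2).measurableSet

theorem weight_nonneg (p : E N → ℝ) (x : E N) : 0 ≤ T.weight p x :=
  Real.rpow_nonneg (localSize_nonneg x) _

/-- For `a ≤ 1` the power `-2` dominates, for `a ≥ 1` the constant does. The constant also covers `a
= 0`, where the power is `0` or `1` by convention. -/
theorem rpow_le_one_add_rpow_neg_two {a s : ℝ} (ha : 0 ≤ a) (hs : -2 ≤ s) (hs' : s ≤ 0) :
    a ^ s ≤ 1 + a ^ (-2 : ℝ) := by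
  have h2 := Real.rpow_nonneg ha (-2)
  rcases ha.eq_or_lt with rfl | ha
  · linarith [Real.zero_rpow_le_one s]
  rcases le_total a 1 with h1 | h1
  · linarith [Real.rpow_le_rpow_of_exponent_ge ha h1 hs]
  · linarith [Real.rpow_le_one_of_one_le_of_nonpos h1 hs']

theorem exists_bound_weight (T : Mesh Ω h) {p : E N → ℝ} {S : Set (E N)} (hp : ∀ x ∈ S, 1 < p x) :
    ∃ C, ∀ x ∈ S, T.weight p x ≤ C := by
  obtain ⟨C, hC⟩ := (T.finite_range_localSize.image fun a : ℝ => 1 + a ^ (-2 : ℝ)).bddAbove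
  refine ⟨C, fun x hx => le_trans (rpow_le_one_add_rpow_neg_two (localSize_nonneg x) ?_ ?_)
    (hC ⟨_, ⟨x, rfl⟩, rfl⟩)⟩
  -- Here `-2 / p' = -2 (p - 1) / p`, so the bound amounts to `p - 1 ≤ p`.
  · have h1 := hp x hx
    rw [div_div_eq_mul_div, le_div_iff₀ (by linarith)]
    linarith
  · have h1 := hp x hx
    exact div_nonpos_of_nonpos_of_nonneg (by norm_num) (div_nonneg (by linarith) (by linarith))

theorem aemeasurable_weight {p : E N → ℝ} {μ : Measure (E N)} (hp : AEMeasurable p μ) :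
    AEMeasurable (T.weight p) μ :=
  T.measurable_localSize.aemeasurable.pow (aemeasurable_const.div (hp.div (hp.sub_const 1)))

/-- The weight is bounded on `S`. Integrability matters because a non-integrable function has
integral `0` by convention, which would spoil the convexity of `funG`. -/
theorem integrable_sq_mul_weight {F : Type*} [NormedAddCommGroup F] {p : E N → ℝ} {S : Set (E N)}
    {μ : Measure (E N)} (hS : MeasurableSet S) (hp : ∀ x ∈ S, 1 < p x)
    (hpm : AEMeasurable p (μ.restrict S)) {f : E N → F} (hf : MemLp f 2 (μ.restrict S)) :
    Integrable (fun x => ‖f x‖ ^ 2 * T.weight p x) (μ.restrict S) := by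
  obtain ⟨C, hC⟩ := T.exists_bound_weight hp
  refine hf.integrable_norm_pow two_ne_zero |>.mul_bdd (c := C)
    (aemeasurable_weight hpm).aestronglyMeasurable ?_
  filter_upwards [ae_restrict_mem hS] with x hx
  rw [Real.norm_of_nonneg (weight_nonneg p x)]
  exact hC x hx

theorem measurableSet_interiorFaces (T : Mesh Ω h) : MeasurableSet T.interiorFaces := by
  have hfin : {e | e ∈ T.faces ∧ dimH (e ∩ frontier Ω) < (N - 1 : ℕ)}.Finite :=
    T.finite_faces.subset fun e he => he.1
  rw [interiorFaces, sUnion_eq_biUnion]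
  exact hfin.measurableSet_biUnion fun e he => (isClosed_of_mem_faces he.1).measurableSet

theorem interiorFaces_subset (T : Mesh Ω h) : T.interiorFaces ⊆ closure Ω := by
  have hκ : ∀ κ ∈ T.cells, κ ⊆ closure Ω := fun κ hκ => by
    rw [← T.iUnion_cells]
    exact subset_biUnion_of_mem (u := fun κ : Set (E N) => κ) hκ
  rintro x ⟨e, ⟨he | he, -⟩, hx⟩
  · obtain ⟨κ, hκ1, κ', -, -, rfl, -⟩ := he
    exact hκ κ hκ1 hx.1
  · obtain ⟨κ, hκ1, rfl, -⟩ := he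
    exact hκ κ hκ1 hx.1

/-! ### Convexity of the functionals -/

/-- The exact convexity defect of a Hilbert norm squared; its last term is the source of the strong
convexity of `funG`. -/
theorem norm_combo_sq {F : Type*} [NormedAddCommGroup F] [InnerProductSpace ℝ F] (a b : F) (t : ℝ) :
    ‖a + t • (b - a)‖ ^ 2 = (1 - t) * ‖a‖ ^ 2 + t * ‖b‖ ^ 2 - t * (1 - t) * ‖b - a‖ ^ 2 := by
  simp only [norm_add_sq_real, norm_sub_sq_real, real_inner_smul_right, inner_sub_right, norm_smul,
    mul_pow, Real.norm_eq_abs, sq_abs, real_inner_self_eq_norm_sq, real_inner_comm a b]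
  ring

theorem val_combo (v v' : T.PolySpace k) (t : ℝ) (x : E N) :
    val (v + t • (v' - v)) x = val v x + t * (val v' x - val v x) := by
  have h1 : v + t • (v' - v) = (1 - t) • v + t • v' := by module
  rw [h1, val_add, val_smul, val_smul]; ring

theorem jump_combo (v v' : T.PolySpace k) (t : ℝ) (x : E N) :
    jump (v + t • (v' - v)) x = jump v x + t • (jump v' x - jump v x) := by
  have h1 : v + t • (v' - v) = (1 - t) • v + t • v' := by module
  rw [h1, jump_add, jump_smul, jump_smul]; module

theorem vecVal_combo (v v' : T.VecSpace l) (t : ℝ) (x : E N) :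
    vecVal (v + t • (v' - v)) x = vecVal v x + t • (vecVal v' x - vecVal v x) := by
  have h1 : v + t • (v' - v) = (1 - t) • v + t • v' := by module
  rw [h1, vecVal_add, vecVal_smul, vecVal_smul]; module

theorem val_sub (v w : T.PolySpace k) (x : E N) : val (v - w) x = val v x - val w x := by
  have h1 : v - w = v + (-1 : ℝ) • w := by module
  rw [h1, val_add, val_smul]; ring

theorem integral_le_combo {α : Type*} [MeasurableSpace α] {μ : Measure α} {f g g' : α → ℝ} {t : ℝ}
    (hf : Integrable f μ) (hg : Integrable g μ) (hg' : Integrable g' μ)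
    (hle : ∀ᵐ x ∂μ, f x ≤ (1 - t) * g x + t * g' x) :
    ∫ x, f x ∂μ ≤ (1 - t) * (∫ x, g x ∂μ) + t * ∫ x, g' x ∂μ := by
  rw [← integral_const_mul, ← integral_const_mul,
    ← integral_add (hg.const_mul _) (hg'.const_mul _)]
  exact integral_mono_ae hf ((hg.const_mul _).add (hg'.const_mul _)) hle

theorem rpow_le_one_add_sq {a s : ℝ} (ha : 0 ≤ a) (hs : 0 ≤ s) (hs' : s ≤ 2) :
    a ^ s ≤ 1 + a ^ 2 := by
  rcases le_total a 1 with h1 | h1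
  · linarith [Real.rpow_le_one ha h1 hs, sq_nonneg a]
  · have := Real.rpow_le_rpow_of_exponent_le h1 hs'
    rw [Real.rpow_two] at this
    linarith

/-- As `p ≤ 2`, the integrand is dominated by `1 + ‖vecVal q x‖²`. -/
theorem integrable_norm_vecVal_rpow {p : E N → ℝ} (hp : ∀ x ∈ Ω, 1 ≤ p x ∧ p x ≤ 2)
    (hpm : AEMeasurable p (volume.restrict Ω)) (q : T.VecSpace l) :
    Integrable (fun x => ‖vecVal q x‖ ^ p x) (volume.restrict Ω) := by
  have := T.isFiniteMeasure_domain
  refine ((integrable_const (1 : ℝ)).add ((memLp_vecVal q).integrable_norm_pow two_ne_zero)).mono'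
    ((measurable_vecVal q).norm.aemeasurable.pow hpm).aestronglyMeasurable ?_
  filter_upwards [ae_restrict_mem T.domain.isOpen.measurableSet] with x hx
  rw [Real.norm_of_nonneg (Real.rpow_nonneg (norm_nonneg _) _)]
  exact rpow_le_one_add_sq (norm_nonneg _) (by linarith [(hp x hx).1]) (hp x hx).2

/-- Pointwise, this is the triangle inequality followed by monotonicity and convexity of `s ↦ s ^ p
x` on `[0, ∞)`. -/
theorem funF_combo_le {p : E N → ℝ} (hp : ∀ x ∈ Ω, 1 ≤ p x ∧ p x ≤ 2)
    (hpm : AEMeasurable p (volume.restrict Ω)) (q q' : T.VecSpace l) (t : ℝ) (ht0 : 0 ≤ t)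
    (ht1 : t ≤ 1) : funF p (q + t • (q' - q)) ≤ (1 - t) * funF p q + t * funF p q' := by
  refine integral_le_combo (integrable_norm_vecVal_rpow hp hpm _)
    (integrable_norm_vecVal_rpow hp hpm _) (integrable_norm_vecVal_rpow hp hpm _) ?_
  filter_upwards [ae_restrict_mem T.domain.isOpen.measurableSet] with x hx
  have h1 : ‖vecVal (q + t • (q' - q)) x‖ ≤ (1 - t) * ‖vecVal q x‖ + t * ‖vecVal q' x‖ := by
    have h2 : vecVal (q + t • (q' - q)) x = (1 - t) • vecVal q x + t • vecVal q' x := by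
      rw [vecVal_combo]; module
    rw [h2]
    refine (norm_add_le _ _).trans (le_of_eq ?_)
    rw [norm_smul, norm_smul, Real.norm_of_nonneg ht0, Real.norm_of_nonneg (sub_nonneg.2 ht1)]
  refine (Real.rpow_le_rpow (norm_nonneg _) h1 (by linarith [(hp x hx).1])).trans ?_
  exact (convexOn_rpow (hp x hx).1).2 (norm_nonneg (vecVal q x)) (norm_nonneg (vecVal q' x))
    (sub_nonneg.2 ht1) ht0 (by ring)

/-- The whole quadratic gain comes from the term with `ξ`, for which equality holds. The face terms
are convex because the weight is nonnegative, and their own gains are dropped. -/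
theorem funG_combo_le {p ξ uD : E N → ℝ} (hp : ∀ x ∈ closure Ω, 1 < p x)
    (hpc : ContinuousOn p (closure Ω)) (hξ : MemLp ξ 2 (volume.restrict Ω))
    (huD : MemLp uD 2 ((surfaceMeasure N).restrict (frontier Ω))) (v v' : T.PolySpace k) (t : ℝ)
    (ht0 : 0 ≤ t) (ht1 : t ≤ 1) :
    funG p ξ uD (v + t • (v' - v)) ≤ (1 - t) * funG p ξ uD v + t * funG p ξ uD v' -
      t * (1 - t) * ‖valL2 T k (v' - v)‖ ^ 2 := by
  have hpm : AEMeasurable p ((surfaceMeasure N).restrict (closure Ω)) :=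
    hpc.aemeasurable isClosed_closure.measurableSet
  have hint1 (w : T.PolySpace k) : Integrable (fun x => |val w x - ξ x| ^ 2) (volume.restrict Ω) :=
    ((memLp_val w).sub hξ).integrable_norm_pow two_ne_zero
  have hint2 (w : T.PolySpace k) := integrable_sq_mul_weight (T := T) T.measurableSet_interiorFaces
    (fun x hx => hp x (T.interiorFaces_subset hx))
    (hpm.mono_measure (Measure.restrict_mono_set _ T.interiorFaces_subset)) (memLp_jump w)
  have hint3 (w : T.PolySpace k) := integrable_sq_mul_weight (T := T)
    isClosed_frontier.measurableSet (fun x hx => hp x (frontier_subset_closure hx))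
    (hpm.mono_measure (Measure.restrict_mono_set _ frontier_subset_closure))
    ((memLp_val_frontier w).sub huD)
  have hconv {F : Type _} [NormedAddCommGroup F] [InnerProductSpace ℝ F] (a b : F) :
      ‖a + t • (b - a)‖ ^ 2 ≤ (1 - t) * ‖a‖ ^ 2 + t * ‖b‖ ^ 2 := by
    rw [norm_combo_sq]
    have := mul_nonneg (mul_nonneg ht0 (sub_nonneg.2 ht1)) (sq_nonneg ‖b - a‖)
    linarith
  -- Subtracting fixed data commutes with convex combinations, so `ξ` and `uD` drop out of the
  -- differences that measure convexity.
  have hval (f : E N → ℝ) (x : E N) : val (v + t • (v' - v)) x - f x =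
      (val v x - f x) + t • ((val v' x - f x) - (val v x - f x)) := by
    rw [val_combo, smul_eq_mul]; ring
  have h1 : ∫ x in Ω, |val (v + t • (v' - v)) x - ξ x| ^ 2 =
      (1 - t) * (∫ x in Ω, |val v x - ξ x| ^ 2) + t * (∫ x in Ω, |val v' x - ξ x| ^ 2) -
        t * (1 - t) * ‖valL2 T k (v' - v)‖ ^ 2 := by
    have hint4 : Integrable (fun x => (1 - t) * |val v x - ξ x| ^ 2 + t * |val v' x - ξ x| ^ 2)
        (volume.restrict Ω) := ((hint1 v).const_mul _).add ((hint1 v').const_mul _)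
    have hint5 : Integrable (fun x => t * (1 - t) * |val (v' - v) x| ^ 2) (volume.restrict Ω) :=
      ((memLp_val (v' - v)).integrable_norm_pow two_ne_zero).const_mul _
    rw [norm_valL2_sq, ← integral_const_mul, ← integral_const_mul, ← integral_const_mul,
      ← integral_add ((hint1 v).const_mul _) ((hint1 v').const_mul _), ← integral_sub hint4 hint5]
    refine integral_congr_ae (ae_of_all _ fun x => ?_)
    have h2 := norm_combo_sq (val v x - ξ x) (val v' x - ξ x) t
    simp only [Real.norm_eq_abs] at h2
    simp only [hval, h2, val_sub]
    rw [sub_sub_sub_cancel_right]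
  have h2 := integral_le_combo (t := t) (hint2 (v + t • (v' - v))) (hint2 v) (hint2 v')
    (ae_of_all _ fun x => by
      rw [jump_combo]
      have := mul_le_mul_of_nonneg_right (hconv (jump v x) (jump v' x)) (weight_nonneg (T := T) p x)
      linarith)
  have h3 := integral_le_combo (t := t) (hint3 (v + t • (v' - v))) (hint3 v) (hint3 v')
    (ae_of_all _ fun x => by
      simp only [Pi.sub_apply]
      rw [hval]
      have := mul_le_mul_of_nonneg_right (hconv (val v x - uD x) (val v' x - uD x))
        (weight_nonneg (T := T) p x)
      linarith)
  simp only [Pi.sub_apply, Real.norm_eq_abs] at h3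
  simp only [funG]
  linarith

/-! ### The augmented Lagrangian in `L²` and its saddle points -/

theorem lagrangian_eq (p ξ uD : E N → ℝ) (hkl : k ≤ l + 1) (r : ℝ) (v : T.PolySpace k)
    (q μ : T.VecSpace l) : lagrangian p ξ uD hkl r v q μ =
      funF p q + funG p ξ uD v + ⟪vecValL2 T l μ, vecValL2 T l (opBMap T hkl v - q)⟫ +
        r / 2 * ‖vecValL2 T l (opBMap T hkl v - q)‖ ^ 2 := by
  rw [lagrangian, inner2_eq, inner2_eq, real_inner_self_eq_norm_sq, opBMap_apply]

/-- In the multiplier the Lagrangian is affine with slope `B u - η`, and it is maximal at `lam`. A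
step from `lam` in the direction of the slope forces the slope to vanish in `L²`, hence in `H` by
injectivity. -/
theorem IsSaddlePoint.eq_opB {p ξ uD : E N → ℝ} {hkl : k ≤ l + 1} {r : ℝ} {u : T.PolySpace k}
    {η lam : T.VecSpace l} (hs : IsSaddlePoint p ξ uD hkl r u η lam) : η = opB hkl u := by
  have h1 := (hs u η (lam + (opB hkl u - η))).1
  rw [lagrangian_eq, lagrangian_eq, opBMap_apply, map_add, inner_add_left,
    real_inner_self_eq_norm_sq] at h1
  have h2 : ‖vecValL2 T l (opB hkl u - η)‖ = 0 := by
    rw [← sq_eq_zero_iff]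
    exact le_antisymm (by linarith) (sq_nonneg _)
  have h3 := vecValL2_injective ((norm_eq_zero.1 h2).trans (map_zero _).symm)
  exact (sub_eq_zero.1 h3).symm

end Mesh

end DG

end

/-! ### Convergence of the algorithm -/

theorem theorem1p3 {N : ℕ} (hN : 2 ≤ N) {Ω : Set (DG.E N)} {h : ℝ} (T : DG.Mesh Ω h)
    (k l : ℕ) (hkl : k ≤ l + 1)
    (p : DG.E N → ℝ) (p₁ : ℝ) (hp₁ : 1 < p₁) (hp : ∀ x ∈ closure Ω, p₁ ≤ p x ∧ p x ≤ 2)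
    (hplog : DG.LogHolderOn p (closure Ω))
    (ξ : DG.E N → ℝ) (hξ : MemLp ξ 2 (volume.restrict Ω))
    (uD : DG.E N → ℝ) (huD : MemLp uD 2 ((DG.surfaceMeasure N).restrict (frontier Ω)))
    (r : ℝ) (u : T.PolySpace k) (η lam : T.VecSpace l)
    (hsaddle : DG.Mesh.IsSaddlePoint p ξ uD hkl r u η lam)
    (ρ : ℕ → ℝ) (α₀ α₁ : ℝ) (hα₀ : 0 < α₀) (hα₁ : α₁ < 2 * r)
    (hρ : ∀ n, α₀ ≤ ρ n ∧ ρ n ≤ α₁)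
    (un : ℕ → T.PolySpace k) (ηn lamn : ℕ → T.VecSpace l)
    (halg : DG.Mesh.IsAlgorithm1 p ξ uD hkl r ρ un ηn lamn) :
    Tendsto (fun n => DG.Mesh.normV (un n - u)) atTop (𝓝 0) ∧
    Tendsto (fun n => DG.Mesh.normH (ηn n - η)) atTop (𝓝 0) ∧
    η = DG.Mesh.opB hkl u ∧
    Tendsto (fun n => DG.Mesh.normH (lamn (n + 1) - lamn n)) atTop (𝓝 0) ∧
    (∃ C : ℝ, ∀ n, DG.Mesh.normH (lamn n) ≤ ENNReal.ofReal C) ∧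
    Tendsto (fun n => DG.Mesh.normJump (un n - u)) atTop (𝓝 0) ∧
    Tendsto (fun n => DG.Mesh.normTrace (un n - u)) atTop (𝓝 0) ∧
    Tendsto (fun n => DG.Mesh.normH (DG.Mesh.lifting l (un n) - DG.Mesh.lifting l u))
      atTop (𝓝 0) ∧
    Tendsto (fun n => DG.Mesh.normH (DG.Mesh.grad hkl (un n) - DG.Mesh.grad hkl u))
      atTop (𝓝 0) := by
  have hpc := hplog.continuousOn
  have hpm : AEMeasurable p (volume.restrict Ω) :=
    (hpc.mono subset_closure).aemeasurable T.domain.isOpen.measurableSet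
  have hη := hsaddle.eq_opB
  obtain ⟨h1, h2, h3⟩ := DG.tendsto_of_augmentedLagrangian (DG.Mesh.vecValL2 T l)
    (DG.Mesh.valL2 T k) (DG.Mesh.opBMap T hkl) (F := DG.Mesh.funF p) (G := DG.Mesh.funG p ξ uD)
    (DG.Mesh.funF_combo_le (fun x hx => ⟨hp₁.le.trans (hp x (subset_closure hx)).1,
      (hp x (subset_closure hx)).2⟩) hpm)
    (DG.Mesh.funG_combo_le (fun x hx => hp₁.trans_le (hp x hx).1) hpc hξ huD) hη
    -- The multiplier passed to `hsaddle` is a dummy: the right-hand inequality does not involve it.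
    (lam := lam) (r := r) (fun v q => by simpa only [DG.Mesh.lagrangian_eq] using (hsaddle v q lam).2)
    hα₀ hα₁ hρ (lamn := lamn)
    (fun n v q => by simpa only [DG.Mesh.lagrangian_eq] using halg.minimizes n v q) halg.update
  -- All the remaining statements about `un n - u` are instances of this one.
  have hV {W : Type} [NormedAddCommGroup W] [NormedSpace ℝ W] (Φ : T.PolySpace k →ₗ[ℝ] W) :
      Tendsto (fun n => Φ (un n - u)) atTop (𝓝 0) :=
    DG.tendsto_zero_of_injective DG.Mesh.valL2_injective Φ h1
  refine ⟨DG.tendsto_toL2_iff.1 h1, DG.Mesh.tendsto_vecValL2_iff.1 ?_, hη, DG.Mesh.tendsto_vecValL2_iff.1 ?_, ?_,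
    DG.tendsto_toL2_iff.1 (hV (DG.Mesh.jumpL2 T k)),
    DG.tendsto_toL2_iff.1 (hV (DG.Mesh.traceL2 T k)), ?_, ?_⟩
  -- Since `η = B u`, the error is `ηn n - η = B (un n - u) - (B (un n) - ηn n)`, a difference of
  -- two null sequences.
  · have h4 := (hV (DG.Mesh.vecValL2 T l ∘ₗ DG.Mesh.opBMap T hkl)).sub h2
    rw [sub_zero] at h4
    refine h4.congr fun n => ?_
    rw [LinearMap.comp_apply, map_sub (DG.Mesh.opBMap T hkl), ← map_sub, sub_sub_sub_cancel_left,
      hη, DG.Mesh.opBMap_apply]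
  -- The increment of the multiplier is a bounded step size times the vanishing residual.
  · have h4 : Tendsto (fun n => ρ n • DG.Mesh.vecValL2 T l (DG.Mesh.opBMap T hkl (un n) - ηn n))
        atTop (𝓝 0) := by
      refine (isBoundedUnder_of ⟨α₁, fun n => ?_⟩).smul_tendsto_zero h2
      rw [Function.comp_apply, Real.norm_of_nonneg (hα₀.le.trans (hρ n).1)]
      exact (hρ n).2
    refine h4.congr fun n => ?_
    rw [halg.update, add_sub_cancel_left, ← map_smul, DG.Mesh.opBMap_apply]
  -- The distance to `lam` never exceeds its initial value; the triangle inequality gives the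
  -- constant.
  · refine ⟨‖DG.Mesh.vecValL2 T l (lamn 0 - lam)‖ + ‖DG.Mesh.vecValL2 T l lam‖, fun n => ?_⟩
    have h4 : ‖DG.Mesh.vecValL2 T l (lamn n)‖ ≤
        ‖DG.Mesh.vecValL2 T l (lamn 0 - lam)‖ + ‖DG.Mesh.vecValL2 T l lam‖ := by
      have h5 : DG.Mesh.vecValL2 T l (lamn n) =
          DG.Mesh.vecValL2 T l (lamn n - lam) + DG.Mesh.vecValL2 T l lam := by
        rw [← map_add, sub_add_cancel]
      rw [h5]
      exact (norm_add_le _ _).trans (by linarith [h3 n])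
    rw [DG.Mesh.norm_vecValL2 (lamn n)] at h4
    exact (ENNReal.le_ofReal_iff_toReal_le (DG.Mesh.memLp_vecVal (lamn n)).2.ne
      (ENNReal.toReal_nonneg.trans h4)).2 h4
  · have h4 := (DG.Mesh.tendsto_vecValL2_iff (q := fun n => DG.Mesh.liftingMap T k l (un n - u))).1
      (hV (DG.Mesh.vecValL2 T l ∘ₗ DG.Mesh.liftingMap T k l))
    simp only [map_sub] at h4
    exact h4
  · have h4 := (DG.Mesh.tendsto_vecValL2_iff (q := fun n => DG.Mesh.gradMap T hkl (un n - u))).1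
      (hV (DG.Mesh.vecValL2 T l ∘ₗ DG.Mesh.gradMap T hkl))
    simp only [map_sub] at h4
    exact h4
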